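/- Let $\mathcal H$ be the single-mode Hilbert space with orthonormal Fock basis $(|n\rangle)_{n\in\mathbb N}$, and for $\alpha\in\mathbb C$ let $|\alpha\rangle=e^{-|\alpha|^2/2}\sum_{n\ge0}\frac{\alpha^n}{\sqrt{n!}}|n\rangle$ be the coherent state. Heterodyne detection of a density operator $\rho$ on $\mathcal H$ (positive, trace one) yields an outcome in $\mathbb C$ with probability density $Q_\rho(\alpha)=\frac1\pi\mathrm{Tr}(|\alpha\rangle\langle\alpha|\rho)$ with respect to Lebesgue measure. For $k,l\in\mathbb N$ and $z\in\mathbb C$ put $$\mathcal L_{k,l}(z)=e^{zz^*}\frac{(-1)^{k+l}}{\sqrt{k!}\sqrt{l!}}\frac{\partial^{k+l}}{\partial z^k\,\partial z^{*l}}e^{-zz^*}.$$ For $E\in\mathbb N$, an operator $A$ with matrix elements $A_{kl}=\langle k|A|l\rangle$, and $0<\eta<1$, put $$f_A(z,\eta)=\frac1\eta e^{(1-\frac1\eta)zz^*}\sum_{k,l=0}^{E}\frac{A_{kl}}{\sqrt{\eta^{k+l}}}\,\mathcal L_{k,l}\!\left(\frac z{\sqrt\eta}\right),\qquad K_A=\sum_{k,l=0}^E|A_{kl}|\sqrt{(k+1)(l+1)}.$$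 Theorem (Reliable heterodyne tomography). Let $0<\epsilon<1$, $\epsilon'>0$, $n\ge1$, $E\in\mathbb N$, let $\rho=\sum_{k,l=0}^E\rho_{kl}|k\rangle\langle l|$ be a density operator with bounded support, and let $\alpha_1,\dots,\alpha_n$ be the (independent, $Q_\rho$-distributed) samples obtained by measuring $n$ copies of $\rho$ with heterodyne detection. Put $$\rho^\epsilon_{kl}=\frac1n\sum_{i=1}^n f_{|l\rangle\langle k|}\!\left(\alpha_i,\frac{\epsilon}{K_{|l\rangle\langle k|}}\right).$$ Then, with probability greater than $$1-4\sum_{0\le k\le l\le E}\exp\left[-\frac{n\,\epsilon^{2+k+l}\,\epsilon'^2}{4C_{kl}}\right],\qquad C_{kl}=\left[(k+1)(l+1)\right]^{1+\frac{k+l}2}\,2^{|l-k|}\binom{\max(k,l)}{\min(k,l)},$$ one has $|\rho_{kl}-\rho^\epsilon_{kl}|\le\epsilon+\epsilon'$ simultaneously for all $0\le k,l\le E$. -/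

import Mathlib

open MeasureTheory ProbabilityTheory

noncomputable section

namespace Heterodyne

/-- The single-mode Hilbert space, realised as `ℓ²(ℕ, ℂ)`. -/
abbrev Fock : Type := lp (fun _ : ℕ => ℂ) 2

/-- The Fock basis vector `|n⟩`. -/
def fock (n : ℕ) : Fock := lp.single 2 n (1 : ℂ)

/-- The operator `|x⟩⟨y|`, i.e. `v ↦ ⟨y, v⟩ x`. -/
def ketbra (x y : Fock) : Fock →L[ℂ] Fock := InnerProductSpace.rankOne ℂ x y

/-- The matrix element `A_{kl} = ⟨k|A|l⟩` in the Fock basis. -/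
def matEl (A : Fock →L[ℂ] Fock) (k l : ℕ) : ℂ := inner ℂ (fock k) (A (fock l))

/-- The trace, computed in the Fock basis (meaningful for trace-class operators). -/
def trace (A : Fock →L[ℂ] Fock) : ℂ := ∑' n : ℕ, matEl A n n

/-- A density operator: positive, trace class, with trace one. For a positive operator,
convergence of the diagonal sum in one orthonormal basis is being trace class. -/
structure IsDensityOperator (ρ : Fock →L[ℂ] Fock) : Prop where
  isPositive : ρ.IsPositive
  hasSum_diag : HasSum (fun n : ℕ => matEl ρ n n) 1

/-- Bounded support over the Fock basis: `ρ = ∑_{k,l=0}^E ρ_{kl} |k⟩⟨l|`. -/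
def HasBoundedSupport (E : ℕ) (ρ : Fock →L[ℂ] Fock) : Prop :=
  ρ = ∑ k ∈ Finset.range (E + 1), ∑ l ∈ Finset.range (E + 1),
    matEl ρ k l • ketbra (fock k) (fock l)

/-- The coefficients of a coherent state are square summable. -/
theorem memlp_coherent (α : ℂ) :
    Memℓp (fun n : ℕ => (Real.exp (-‖α‖ ^ 2 / 2) : ℂ) * (α ^ n / (Real.sqrt n.factorial : ℂ)))
      2 := by
  refine memℓp_gen ?_
  have h := (Real.summable_pow_div_factorial (‖α‖ ^ 2)).mul_left (Real.exp (-‖α‖ ^ 2 / 2) ^ 2)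
  refine h.congr fun n => ?_
  have h2 : (2 : ENNReal).toReal = ((2 : ℕ) : ℝ) := by norm_num
  have h3 : ‖(Real.sqrt n.factorial : ℂ)‖ = Real.sqrt n.factorial := by
    rw [Complex.norm_real, Real.norm_of_nonneg (Real.sqrt_nonneg _)]
  have h4 : ‖(Real.exp (-‖α‖ ^ 2 / 2) : ℂ)‖ = Real.exp (-‖α‖ ^ 2 / 2) := by
    rw [Complex.norm_real, Real.norm_of_nonneg (Real.exp_pos _).le]
  rw [h2, Real.rpow_natCast, norm_mul, norm_div, norm_pow, h3, h4, mul_pow, div_pow,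
    Real.sq_sqrt (Nat.cast_nonneg _), ← pow_mul, ← pow_mul, mul_comm n 2]

/-- The coherent state `|α⟩ = e^{-|α|²/2} ∑_n (αⁿ / √n!) |n⟩`. -/
def coherent (α : ℂ) : Fock :=
  ⟨fun n : ℕ => (Real.exp (-‖α‖ ^ 2 / 2) : ℂ) * (α ^ n / (Real.sqrt n.factorial : ℂ)),
    memlp_coherent α⟩

/-- The Husimi function `Q_ρ(α) = (1/π) Tr(|α⟩⟨α| ρ)` (a real number for a density operator). -/
def husimiQ (ρ : Fock →L[ℂ] Fock) (α : ℂ) : ℝ :=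
  1 / Real.pi * (trace (ketbra (coherent α) (coherent α) ∘L ρ)).re

/-- The law of the outcome of heterodyne detection of `ρ`: density `Q_ρ` with respect to the
Lebesgue measure on `ℂ`. -/
def heterodyneLaw (ρ : Fock →L[ℂ] Fock) : Measure ℂ :=
  (volume : Measure ℂ).withDensity fun α => ENNReal.ofReal (husimiQ ρ α)

/-- The Wirtinger derivative `∂/∂z = (∂/∂x - i ∂/∂y) / 2`. -/
def dz (g : ℂ → ℂ) (z : ℂ) : ℂ :=
  (fderiv ℝ g z 1 - Complex.I * fderiv ℝ g z Complex.I) / 2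

/-- The Wirtinger derivative `∂/∂z* = (∂/∂x + i ∂/∂y) / 2`. -/
def dzbar (g : ℂ → ℂ) (z : ℂ) : ℂ :=
  (fderiv ℝ g z 1 + Complex.I * fderiv ℝ g z Complex.I) / 2

/-- The (normalised) Laguerre 2D polynomials
`𝓛_{k,l}(z) = e^{z z*} (-1)^{k+l} / (√k! √l!) ∂^{k+l} / (∂z^k ∂z*^l) e^{-z z*}`. -/
def laguerre2D (k l : ℕ) (z : ℂ) : ℂ :=
  Complex.exp (z * star z) *
    ((-1) ^ (k + l) / ((Real.sqrt k.factorial : ℂ) * (Real.sqrt l.factorial : ℂ))) *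
    (dz^[k] (dzbar^[l] fun w : ℂ => Complex.exp (-(w * star w)))) z

/-- The function `f_A(z, η)` with cutoff `E`. -/
def estFun (E : ℕ) (A : Fock →L[ℂ] Fock) (z : ℂ) (η : ℝ) : ℂ :=
  1 / (η : ℂ) * Complex.exp ((1 - 1 / (η : ℂ)) * (z * star z)) *
    ∑ k ∈ Finset.range (E + 1), ∑ l ∈ Finset.range (E + 1),
      matEl A k l / (Real.sqrt (η ^ (k + l)) : ℂ) * laguerre2D k l (z / (Real.sqrt η : ℂ))

/-- The constant `K_A` with cutoff `E`. -/
def constK (E : ℕ) (A : Fock →L[ℂ] Fock) : ℝ :=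
  ∑ k ∈ Finset.range (E + 1), ∑ l ∈ Finset.range (E + 1),
    ‖matEl A k l‖ * Real.sqrt (((k : ℝ) + 1) * ((l : ℝ) + 1))

/-- The estimate `ρ^ε_{kl}` computed from the samples `α 0, …, α (n - 1)`: the average of
`f_{|l⟩⟨k|}(·, ε / K_{|l⟩⟨k|})`. -/
def estimate (E : ℕ) {n : ℕ} (ε : ℝ) (α : Fin n → ℂ) (k l : ℕ) : ℂ :=
  1 / (n : ℂ) * ∑ i : Fin n,
    estFun E (ketbra (fock l) (fock k)) (α i) (ε / constK E (ketbra (fock l) (fock k)))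

/-- The constant `C_{kl} = [(k+1)(l+1)]^{1+(k+l)/2} 2^{|l-k|} binom(max(k,l), min(k,l))`. -/
def constC (k l : ℕ) : ℝ :=
  (((k : ℝ) + 1) * ((l : ℝ) + 1)) ^ (1 + ((k : ℝ) + (l : ℝ)) / 2) *
    (2 : ℝ) ^ ((l : ℤ) - (k : ℤ)).natAbs * ((max k l).choose (min k l) : ℝ)

end Heterodyne

end

namespace Heterodyne

open ComplexConjugate Filter Topology

/-! The error splits into bias and statistical fluctuation, with `η = ε / √((k+1)(l+1))` for the
entry `(k, l)`.

Bias at most `ε`: against a Gaussian monomial of the Husimi function, the substitution `z = √η w`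
merges all exponentials into `e^{-|w|²}`, leaving moments of a Laguerre 2D polynomial
(`integral_moment_lagPoly`). They vanish except on the diagonal `(k+p, l+p)`, so the mean is `ρ_{kl}
+ ∑_{p ≥ 1} η^p √(C(k+p,k) C(l+p,l)) ρ_{k+p,l+p}` (`meanCoeff_add`). Since `C(k+p,k) ≤ (k+1)^p`,
each error coefficient is at most `ε^p ≤ ε`; positivity and trace one bound the sum of the
`|ρ_{k+p,l+p}|` by 1.

Fluctuation at most `ε'`: the estimator is bounded, with square at most `C_{kl} / ε^{2+k+l}`
(`norm_sq_entryEst_le`). The key input is `∑_l |𝓛_{k,l}(w)|² = e^{|w|²}`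
(`hasSum_norm_sq_laguerre2D`), the unitarity of displacement operators, proved here by telescoping.
Hoeffding's inequality for the real and imaginary parts gives each pair a failure probability at
most `4 exp(...)`.

A union bound over `k ≤ l` suffices because matrix and estimate are Hermitian. Strictness comes from
the diagonal, where the estimator is real and the prefactor 2 is enough. -/

/-- The unnormalised Laguerre 2D polynomials, defined by their three-term recursion. -/
noncomputable def lagPoly : ℕ → ℕ → ℂ → ℂ
  | 0, l => fun w => w ^ l
  | k + 1, l => fun w => conj w * lagPoly k l w - l * lagPoly k (l - 1) w

theorem lagPoly_zero_left (l : ℕ) (w : ℂ) : lagPoly 0 l w = w ^ l := rfl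

theorem lagPoly_succ_left (k l : ℕ) (w : ℂ) :
    lagPoly (k + 1) l w = conj w * lagPoly k l w - l * lagPoly k (l - 1) w := rfl

/-- The defining recursion raises only the first index; raising the second commutes with it. After
both expansions the discrepancy is a multiple of the induction hypothesis at the lower second index.
Truncated subtraction at 0 is harmless, since the coefficient in front vanishes there. -/
theorem lagPoly_succ_right (k l : ℕ) (w : ℂ) :
    lagPoly k (l + 1) w = w * lagPoly k l w - k * lagPoly (k - 1) l w := by
  induction k generalizing l with
  | zero => simp [lagPoly_zero_left, pow_succ, mul_comm]
  | succ k ih =>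
    rw [lagPoly_succ_left, ih, lagPoly_succ_left]
    rcases l with _ | l
    · rcases k with _ | k
      · simp [lagPoly_zero_left]; ring
      · simp [lagPoly_succ_left]; ring
    · rcases k with _ | k
      · simp only [Nat.add_sub_cancel, lagPoly_zero_left]; push_cast; ring
      · have h := ih l
        simp only [Nat.add_sub_cancel, lagPoly_succ_left k (l + 1)] at h ⊢
        push_cast at h ⊢
        linear_combination -((l : ℂ) + 1) * h

theorem lagPoly_zero_right (k : ℕ) (w : ℂ) : lagPoly k 0 w = conj w ^ k := by
  induction k with
  | zero => rfl
  | succ k ih => simp [lagPoly_succ_left, ih, pow_succ, mul_comm]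

theorem lagPoly_swap (k l : ℕ) (w : ℂ) : lagPoly l k w = conj (lagPoly k l w) := by
  induction k generalizing l with
  | zero => simp [lagPoly_zero_left, lagPoly_zero_right]
  | succ k ih => rw [lagPoly_succ_right, ih, ih, lagPoly_succ_left]; simp

@[fun_prop]
theorem continuous_lagPoly (k l : ℕ) : Continuous (lagPoly k l) := by
  induction k generalizing l with
  | zero => exact continuous_pow l
  | succ k ih =>
    exact (Complex.continuous_conj.mul (ih l)).sub (continuous_const.mul (ih (l - 1)))

/-! ### Wirtinger derivatives -/

/-- `g` is real differentiable at `w`, with Wirtinger derivatives `a` and `b`. -/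
def HasWirtingerDerivAt (g : ℂ → ℂ) (a b w : ℂ) : Prop :=
  HasFDerivAt g (a • (1 : ℂ →L[ℝ] ℂ) + b • (Complex.conjCLE : ℂ →L[ℝ] ℂ)) w

theorem HasWirtingerDerivAt.dz_eq {g : ℂ → ℂ} {a b w : ℂ} (h : HasWirtingerDerivAt g a b w) :
    dz g w = a := by
  rw [dz, h.fderiv]
  simp
  linear_combination (-a / 2 + b / 2) * Complex.I_mul_I

theorem HasWirtingerDerivAt.dzbar_eq {g : ℂ → ℂ} {a b w : ℂ}
    (h : HasWirtingerDerivAt g a b w) : dzbar g w = b := by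
  rw [dzbar, h.fderiv]
  simp
  linear_combination (a / 2 - b / 2) * Complex.I_mul_I

theorem hasWirtingerDerivAt_const (c w : ℂ) : HasWirtingerDerivAt (fun _ => c) 0 0 w := by
  exact (hasFDerivAt_const (𝕜 := ℝ) c w).congr_fderiv (ContinuousLinearMap.ext fun v => by simp)

theorem hasWirtingerDerivAt_id (w : ℂ) : HasWirtingerDerivAt (fun z => z) 1 0 w := by
  exact (hasFDerivAt_id (𝕜 := ℝ) w).congr_fderiv (ContinuousLinearMap.ext fun v => by simp)

theorem hasWirtingerDerivAt_conj (w : ℂ) : HasWirtingerDerivAt (fun z => conj z) 0 1 w := by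
  exact (Complex.conjCLE.hasFDerivAt (x := w)).congr_fderiv
    (ContinuousLinearMap.ext fun v => by simp)

theorem HasWirtingerDerivAt.congr {g : ℂ → ℂ} {a b a' b' w : ℂ}
    (h : HasWirtingerDerivAt g a b w) (ha : a = a') (hb : b = b') :
    HasWirtingerDerivAt g a' b' w := ha ▸ hb ▸ h

theorem HasWirtingerDerivAt.sub {f g : ℂ → ℂ} {a b c d w : ℂ}
    (hf : HasWirtingerDerivAt f a b w) (hg : HasWirtingerDerivAt g c d w) :
    HasWirtingerDerivAt (fun z => f z - g z) (a - c) (b - d) w := by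
  refine (HasFDerivAt.sub hf hg).congr_fderiv ?_
  refine ContinuousLinearMap.ext fun v => ?_
  simp
  ring

theorem HasWirtingerDerivAt.mul {f g : ℂ → ℂ} {a b c d w : ℂ}
    (hf : HasWirtingerDerivAt f a b w) (hg : HasWirtingerDerivAt g c d w) :
    HasWirtingerDerivAt (fun z => f z * g z) (f w * c + a * g w) (f w * d + b * g w) w := by
  refine (HasFDerivAt.mul hf hg).congr_fderiv ?_
  refine ContinuousLinearMap.ext fun v => ?_
  simp
  ring

theorem HasWirtingerDerivAt.cexp {f : ℂ → ℂ} {a b w : ℂ} (hf : HasWirtingerDerivAt f a b w) :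
    HasWirtingerDerivAt (fun z => Complex.exp (f z)) (Complex.exp (f w) * a)
      (Complex.exp (f w) * b) w := by
  refine (HasFDerivAt.cexp hf).congr_fderiv ?_
  refine ContinuousLinearMap.ext fun v => ?_
  simp
  ring

theorem hasWirtingerDerivAt_pow (l : ℕ) (w : ℂ) :
    HasWirtingerDerivAt (fun z => z ^ l) (l * w ^ (l - 1)) 0 w := by
  induction l with
  | zero => simpa using hasWirtingerDerivAt_const 1 w
  | succ l ih =>
    refine (ih.mul (hasWirtingerDerivAt_id w)).congr ?_ (by simp)
    rcases l with _ | l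
    · simp
    · simp [pow_succ]; ring

/-- Each Wirtinger derivative lowers one index, so differentiating polynomial times Gaussian
reproduces the recursion with a minus sign. -/
theorem hasWirtingerDerivAt_lagPoly (k l : ℕ) (w : ℂ) :
    HasWirtingerDerivAt (lagPoly k l) (l * lagPoly k (l - 1) w) (k * lagPoly (k - 1) l w) w := by
  induction k generalizing l with
  | zero => exact (hasWirtingerDerivAt_pow l w).congr rfl (by simp)
  | succ k ih =>
    have h := ((hasWirtingerDerivAt_conj w).mul (ih l)).sub
      ((hasWirtingerDerivAt_const l w).mul (ih (l - 1)))
    refine h.congr ?_ ?_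
    · rw [lagPoly_succ_left]; ring
    · rcases k with _ | k
      · simp
      · rw [Nat.add_sub_cancel, Nat.add_sub_cancel, lagPoly_succ_left k l]
        push_cast; ring

theorem hasWirtingerDerivAt_gaussian (w : ℂ) :
    HasWirtingerDerivAt (fun z => Complex.exp (-(z * star z)))
      (-(Complex.exp (-(w * star w)) * conj w)) (-(Complex.exp (-(w * star w)) * w)) w := by
  have h := ((hasWirtingerDerivAt_const 0 w).sub
    ((hasWirtingerDerivAt_id w).mul (hasWirtingerDerivAt_conj w))).cexp
  simpa using h

theorem dzbar_iterate_gaussian (l : ℕ) :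
    dzbar^[l] (fun w : ℂ => Complex.exp (-(w * star w))) =
      fun w => (-1) ^ l * (lagPoly 0 l w * Complex.exp (-(w * star w))) := by
  induction l with
  | zero => ext w; simp [lagPoly_zero_left]
  | succ l ih =>
    rw [Function.iterate_succ_apply', ih]
    ext w
    rw [((hasWirtingerDerivAt_const ((-1) ^ l) w).mul
      ((hasWirtingerDerivAt_lagPoly 0 l w).mul (hasWirtingerDerivAt_gaussian w))).dzbar_eq]
    simp [lagPoly_zero_left]; ring

theorem dz_iterate_gaussian (k l : ℕ) :
    dz^[k] (dzbar^[l] fun w : ℂ => Complex.exp (-(w * star w))) =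
      fun w => (-1) ^ (k + l) * (lagPoly k l w * Complex.exp (-(w * star w))) := by
  induction k with
  | zero => rw [Function.iterate_zero, id, dzbar_iterate_gaussian, zero_add]
  | succ k ih =>
    rw [Function.iterate_succ_apply', ih]
    ext w
    rw [((hasWirtingerDerivAt_const ((-1) ^ (k + l)) w).mul
      ((hasWirtingerDerivAt_lagPoly k l w).mul (hasWirtingerDerivAt_gaussian w))).dz_eq,
      lagPoly_succ_left]
    ring

/-- The sign and Gaussian produced by the derivatives cancel the prefactors in the definition. -/
theorem laguerre2D_eq (k l : ℕ) (z : ℂ) :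
    laguerre2D k l z =
      lagPoly k l z / ((Real.sqrt k.factorial : ℂ) * (Real.sqrt l.factorial : ℂ)) := by
  rw [laguerre2D, dz_iterate_gaussian]
  have h : Complex.exp (z * star z) * Complex.exp (-(z * star z)) = 1 := by
    rw [← Complex.exp_add]; simp
  have h2 : ((-1 : ℂ) ^ (k + l)) * (-1) ^ (k + l) = 1 := by
    rw [← mul_pow]; simp
  linear_combination (lagPoly k l z /
    ((Real.sqrt k.factorial : ℂ) * (Real.sqrt l.factorial : ℂ))) *
    ((-1 : ℂ) ^ (k + l) * (-1) ^ (k + l) * h + h2)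

theorem continuous_laguerre2D (k l : ℕ) : Continuous (laguerre2D k l) := by
  rw [funext (laguerre2D_eq k l)]
  fun_prop

/-! ### The unitarity bound -/

theorem laguerre2D_zero_left (l : ℕ) (w : ℂ) :
    laguerre2D 0 l w = w ^ l / (Real.sqrt l.factorial : ℂ) := by
  simp [laguerre2D_eq, lagPoly_zero_left]

/-- With the factorial normalisation, the recursion takes ladder-operator form with square-root
coefficients. -/
theorem sqrt_mul_laguerre2D_succ_left (k l : ℕ) (w : ℂ) :
    (Real.sqrt (k + 1 : ℕ) : ℂ) * laguerre2D (k + 1) l w =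
      conj w * laguerre2D k l w - (Real.sqrt l : ℂ) * laguerre2D k (l - 1) w := by
  have hne (n : ℕ) : (Real.sqrt n.factorial : ℂ) ≠ 0 := by
    exact_mod_cast (Real.sqrt_pos.2 (by positivity)).ne'
  have hs (n : ℕ) : (Real.sqrt (n + 1 : ℕ) : ℂ) ≠ 0 := by
    exact_mod_cast (Real.sqrt_pos.2 (by positivity)).ne'
  have hf (n : ℕ) : (Real.sqrt (n + 1).factorial : ℂ) =
      (Real.sqrt (n + 1 : ℕ) : ℂ) * (Real.sqrt n.factorial : ℂ) := by
    rw [Nat.factorial_succ, Nat.cast_mul, Real.sqrt_mul (by positivity)]; push_cast; rfl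
  have hsq (n : ℕ) : (n : ℂ) = (Real.sqrt n : ℂ) * (Real.sqrt n : ℂ) := by
    rw [← Complex.ofReal_mul, Real.mul_self_sqrt (by positivity)]; simp
  simp only [laguerre2D_eq, lagPoly_succ_left]
  rcases l with _ | l
  · rw [hf k]
    have := hne k; have := hs k; have := hne 0
    simp only [CharP.cast_eq_zero, zero_mul, sub_zero, Real.sqrt_zero, Complex.ofReal_zero]
    field_simp
  · rw [hf k, hf l, hsq (l + 1), Nat.add_sub_cancel]
    have := hne k; have := hs k; have := hne l; have := hs l
    field_simp

theorem laguerre2D_swap (k l : ℕ) (w : ℂ) : laguerre2D l k w = conj (laguerre2D k l w) := by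
  rw [laguerre2D_eq, laguerre2D_eq, lagPoly_swap]
  simp [mul_comm]

theorem sqrt_mul_laguerre2D_succ_right (k l : ℕ) (w : ℂ) :
    (Real.sqrt (l + 1 : ℕ) : ℂ) * laguerre2D k (l + 1) w =
      w * laguerre2D k l w - (Real.sqrt k : ℂ) * laguerre2D (k - 1) l w := by
  have h := congrArg conj (sqrt_mul_laguerre2D_succ_left l k w)
  simpa [← laguerre2D_swap] using h

/-- Needed to discard the boundary term of the telescoping sum. Raising `k` costs a factor growing
like `√l`, which the recursion in `l` absorbs; this brings in both `k` and `k - 1`, hence strong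
induction. -/
theorem tendsto_laguerre2D_atTop (k : ℕ) (w : ℂ) :
    Tendsto (fun l => laguerre2D k l w) atTop (𝓝 0) := by
  induction k using Nat.strong_induction_on with
  | _ k ih =>
    rcases k with _ | k
    · have h := (Real.summable_pow_div_factorial (‖w‖ ^ 2)).tendsto_atTop_zero.sqrt
      rw [Real.sqrt_zero] at h
      refine squeeze_zero_norm (fun l => le_of_eq ?_) h
      rw [laguerre2D_zero_left, Real.sqrt_div (by positivity), ← pow_mul, mul_comm, pow_mul,
        Real.sqrt_sq (by positivity)]
      simp [abs_of_nonneg]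
    · have h0 := ih k k.lt_succ_self
      have h1 : Tendsto (fun l => laguerre2D (k - 1) l w) atTop (𝓝 0) :=
        ih (k - 1) (by omega)
      rw [← tendsto_add_atTop_iff_nat 2]
      have hs : (Real.sqrt (k + 1 : ℕ) : ℂ) ≠ 0 := by
        exact_mod_cast (Real.sqrt_pos.2 (by positivity)).ne'
      have key : ∀ l : ℕ, ‖laguerre2D (k + 1) (l + 2) w‖ ≤
          ‖(Real.sqrt (k + 1 : ℕ) : ℂ)‖⁻¹ * (‖w‖ * ‖laguerre2D k (l + 2) w‖ +
            2 * (‖w‖ * ‖laguerre2D k l w‖ + Real.sqrt k * ‖laguerre2D (k - 1) l w‖)) := by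
        intro l
        have e1 := sqrt_mul_laguerre2D_succ_left k (l + 2) w
        have e2 := sqrt_mul_laguerre2D_succ_right k l w
        -- The 2 comes from `√(l+2) ≤ 2 √(l+1)`, which makes the recursion in `l` applicable.
        have b2 : ‖(Real.sqrt (l + 2 : ℕ) : ℂ) * laguerre2D k (l + 1) w‖ ≤
            2 * (‖w‖ * ‖laguerre2D k l w‖ + Real.sqrt k * ‖laguerre2D (k - 1) l w‖) := by
          calc _ ≤ ‖(2 : ℂ) * ((Real.sqrt (l + 1 : ℕ) : ℂ) * laguerre2D k (l + 1) w)‖ := by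
                rw [← mul_assoc, norm_mul, norm_mul _ (laguerre2D k (l + 1) w)]
                gcongr
                rw [norm_mul, Complex.norm_real, Complex.norm_real,
                  Real.norm_of_nonneg (Real.sqrt_nonneg _),
                  Real.norm_of_nonneg (Real.sqrt_nonneg _), Complex.norm_ofNat]
                rw [Real.sqrt_le_iff]
                refine ⟨by positivity, ?_⟩
                rw [mul_pow, Real.sq_sqrt (by positivity)]
                push_cast; linarith [(Nat.cast_nonneg l : (0 : ℝ) ≤ l)]
            _ ≤ _ := by
                rw [e2, norm_mul, Complex.norm_ofNat]
                gcongr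
                refine (norm_sub_le _ _).trans ?_
                simp [abs_of_nonneg]
        rw [← div_eq_inv_mul, le_div_iff₀ (norm_pos_iff.2 hs), mul_comm, ← norm_mul, e1]
        refine (norm_sub_le _ _).trans ?_
        rw [norm_mul, Complex.norm_conj]
        gcongr
        exact b2
      refine squeeze_zero_norm key ?_
      have h2 := (tendsto_add_atTop_iff_nat 2).2 h0
      have := ((h2.norm.const_mul ‖w‖).add
        (((h0.norm.const_mul ‖w‖).add (h1.norm.const_mul (Real.sqrt k))).const_mul 2)).const_mul
          ‖(Real.sqrt (k + 1 : ℕ) : ℂ)‖⁻¹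
      simpa using this

/-- A Christoffel–Darboux type telescoping: the two recursions make each summand a difference of
consecutive boundary terms. At `N = 0` the boundary term is killed by `√N`. -/
theorem sum_norm_sq_laguerre2D_succ (k N : ℕ) (w : ℂ) :
    ((k + 1 : ℕ) : ℂ) * (∑ l ∈ Finset.range N, (conj (laguerre2D (k + 1) l w) *
        laguerre2D (k + 1) l w - conj (laguerre2D k l w) * laguerre2D k l w)) =
      (Real.sqrt (k + 1 : ℕ) : ℂ) * (Real.sqrt N : ℂ) * conj (laguerre2D (k + 1) N w) *
        laguerre2D k (N - 1) w := by
  induction N with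
  | zero => simp
  | succ N ih =>
    rw [Finset.sum_range_succ, mul_add, ih, Nat.add_sub_cancel]
    have e1 := sqrt_mul_laguerre2D_succ_left k N w
    have e2 := congrArg conj (sqrt_mul_laguerre2D_succ_right (k + 1) N w)
    simp only [map_mul, map_sub, Complex.conj_ofReal, Nat.add_sub_cancel] at e2
    have hsq : ((k + 1 : ℕ) : ℂ) = (Real.sqrt (k + 1 : ℕ) : ℂ) * (Real.sqrt (k + 1 : ℕ) : ℂ) := by
      rw [← Complex.ofReal_mul, Real.mul_self_sqrt (by positivity)]; simp
    rw [hsq]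
    linear_combination (Real.sqrt (k + 1 : ℕ) : ℂ) * conj (laguerre2D (k + 1) N w) * e1 -
      (Real.sqrt (k + 1 : ℕ) : ℂ) * laguerre2D k N w * e2

/-- Row `k = 0` is the exponential series, and consecutive rows have partial sums differing by a
vanishing boundary term. -/
theorem hasSum_norm_sq_laguerre2D (k : ℕ) (w : ℂ) :
    HasSum (fun l => ‖laguerre2D k l w‖ ^ 2) (Real.exp (‖w‖ ^ 2)) := by
  rw [hasSum_iff_tendsto_nat_of_nonneg (fun _ => by positivity)]
  induction k with
  | zero =>
    have h := NormedSpace.expSeries_div_hasSum_exp (‖w‖ ^ 2)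
    rw [← Real.exp_eq_exp_ℝ] at h
    refine h.tendsto_sum_nat.congr fun N => Finset.sum_congr rfl fun l _ => ?_
    rw [laguerre2D_zero_left, norm_div, div_pow, Complex.norm_real,
      Real.norm_of_nonneg (Real.sqrt_nonneg _), Real.sq_sqrt (by positivity), norm_pow,
      ← pow_mul, ← pow_mul, mul_comm]
  | succ k ih =>
    have hk : ((k + 1 : ℕ) : ℂ) ≠ 0 := by exact_mod_cast k.succ_ne_zero
    have hT : Tendsto (fun N : ℕ => (Real.sqrt (k + 1 : ℕ) : ℂ) * (Real.sqrt N : ℂ) *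
        conj (laguerre2D (k + 1) N w) * laguerre2D k (N - 1) w) atTop (𝓝 0) := by
      rw [← tendsto_add_atTop_iff_nat 1]
      have h0 := tendsto_laguerre2D_atTop k w
      have h1 := tendsto_laguerre2D_atTop (k + 1) w
      have h2 := ((((h1.const_mul w).sub (h0.const_mul (Real.sqrt (k + 1 : ℕ) : ℂ))).star).mul
        h0).const_mul (Real.sqrt (k + 1 : ℕ) : ℂ)
      simp only [mul_zero, sub_zero, star_zero] at h2
      -- The recursion in the second index absorbs the growing factor `√(N+1)`, leaving a product of
      -- null sequences.
      refine h2.congr fun N => ?_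
      have e2 := congrArg conj (sqrt_mul_laguerre2D_succ_right (k + 1) N w)
      simp only [map_mul, Complex.conj_ofReal, Nat.add_sub_cancel] at e2
      rw [Nat.add_sub_cancel]
      rw [starRingEnd_apply (w * _ - _)] at e2
      linear_combination -(Real.sqrt (k + 1 : ℕ) : ℂ) * laguerre2D k N w * e2
    have hd : Tendsto (fun N => ∑ l ∈ Finset.range N, (‖laguerre2D (k + 1) l w‖ ^ 2 -
        ‖laguerre2D k l w‖ ^ 2)) atTop (𝓝 0) := by
      have h3 := (Complex.continuous_re.tendsto _).comp (hT.const_mul ((k + 1 : ℕ) : ℂ)⁻¹)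
      simp only [mul_zero, Complex.zero_re] at h3
      refine h3.congr fun N => ?_
      rw [Function.comp, ← sum_norm_sq_laguerre2D_succ, inv_mul_cancel_left₀ hk, Complex.re_sum]
      refine Finset.sum_congr rfl fun l _ => ?_
      rw [Complex.conj_mul', Complex.conj_mul', ← Complex.ofReal_pow, ← Complex.ofReal_pow,
        ← Complex.ofReal_sub, Complex.ofReal_re]
    have := ih.add hd
    rw [add_zero] at this
    refine this.congr fun N => ?_
    rw [Finset.sum_sub_distrib]; ring

theorem norm_sq_laguerre2D_le (k l : ℕ) (w : ℂ) :
    ‖laguerre2D k l w‖ ^ 2 ≤ Real.exp (‖w‖ ^ 2) :=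
  le_hasSum (hasSum_norm_sq_laguerre2D k w) l fun _ _ => by positivity

/-! ### Gaussian moments -/

theorem integral_norm_pow_mul_gaussian (q : ℕ) :
    ∫ w : ℂ, ‖w‖ ^ q * Real.exp (-‖w‖ ^ 2) = Real.pi * Real.Gamma ((q + 2) / 2) := by
  have h := Complex.integral_rpow_mul_exp_neg_rpow (p := 2) (q := q) (by norm_num)
    (by linarith [(Nat.cast_nonneg q : (0 : ℝ) ≤ q)])
  simp only [Real.rpow_natCast, Real.rpow_two] at h
  rw [h]; ring

/-- A non-integrable function would have integral 0, but the computed value is positive. -/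
theorem integrable_norm_pow_mul_gaussian (q : ℕ) :
    Integrable fun w : ℂ => ‖w‖ ^ q * Real.exp (-‖w‖ ^ 2) := by
  by_contra h
  have h1 := integral_norm_pow_mul_gaussian q
  rw [integral_undef h] at h1
  have : 0 < Real.pi * Real.Gamma ((q + 2) / 2) :=
    mul_pos Real.pi_pos (Real.Gamma_pos_of_pos (by positivity))
  linarith

theorem integrable_moment (m n : ℕ) :
    Integrable fun w : ℂ => conj w ^ m * w ^ n * (Real.exp (-‖w‖ ^ 2) : ℂ) := by
  refine (integrable_norm_pow_mul_gaussian (m + n)).mono' ?_ (ae_of_all _ fun w => ?_)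
  · exact Continuous.aestronglyMeasurable (by fun_prop)
  · rw [norm_mul, norm_mul, norm_pow, norm_pow, Complex.norm_conj, ← pow_add, Complex.norm_real,
      Real.norm_of_nonneg (Real.exp_pos _).le]

theorem integral_moment_self (m : ℕ) :
    ∫ w : ℂ, conj w ^ m * w ^ m * (Real.exp (-‖w‖ ^ 2) : ℂ) = Real.pi * m.factorial := by
  have h := integral_norm_pow_mul_gaussian (2 * m)
  have e : ((2 * m : ℕ) + 2 : ℝ) / 2 = m + 1 := by push_cast; ring
  rw [e, Real.Gamma_nat_eq_factorial] at h
  have h2 := congrArg (Complex.ofReal) h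
  rw [← integral_complex_ofReal] at h2
  push_cast at h2
  rw [← h2]
  refine integral_congr_ae (ae_of_all _ fun w => ?_)
  simp only
  rw [← mul_pow, Complex.conj_mul', pow_mul]
  push_cast
  rfl

/-- Rotating by `π / (n - m)` preserves Lebesgue measure and flips the sign of the integrand. -/
theorem integral_moment_of_ne {m n : ℕ} (h : m ≠ n) :
    ∫ w : ℂ, conj w ^ m * w ^ n * (Real.exp (-‖w‖ ^ 2) : ℂ) = 0 := by
  set d : ℝ := (n : ℝ) - m with hd
  have hd0 : d ≠ 0 := sub_ne_zero.2 (by exact_mod_cast h.symm)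
  set c : Circle := Circle.exp (Real.pi / d) with hc
  have hcc : conj (c : ℂ) ^ m * (c : ℂ) ^ n = -1 := by
    rw [hc, ← Circle.coe_inv_eq_conj, ← Circle.exp_neg, Circle.coe_exp, Circle.coe_exp,
      ← Complex.exp_nat_mul, ← Complex.exp_nat_mul, ← Complex.exp_add, ← Complex.exp_pi_mul_I]
    congr 1
    have hd1 : (d : ℂ) ≠ 0 := by exact_mod_cast hd0
    have : (d : ℂ) = n - m := by rw [hd]; push_cast; rfl
    push_cast
    field_simp
    rw [this]; ring
  have hmp := (rotation c).measurePreserving.integral_comp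
    (rotation c).toHomeomorph.measurableEmbedding
    (fun w : ℂ => conj w ^ m * w ^ n * (Real.exp (-‖w‖ ^ 2) : ℂ))
  have e : (fun w : ℂ => conj (rotation c w) ^ m * (rotation c w) ^ n *
      (Real.exp (-‖rotation c w‖ ^ 2) : ℂ)) =
      fun w => -1 * (conj w ^ m * w ^ n * (Real.exp (-‖w‖ ^ 2) : ℂ)) := by
    ext w
    rw [LinearIsometryEquiv.norm_map, rotation_apply, map_mul, mul_pow, mul_pow, ← hcc]
    ring
  rw [e, integral_const_mul] at hmp
  linear_combination (-1 / 2 : ℂ) * hmp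

theorem integral_moment (m n : ℕ) :
    ∫ w : ℂ, conj w ^ m * w ^ n * (Real.exp (-‖w‖ ^ 2) : ℂ) =
      if n = m then (Real.pi * m.factorial : ℂ) else 0 := by
  split_ifs with h
  · rw [h, integral_moment_self]
  · exact integral_moment_of_ne (Ne.symm h)

theorem integrable_moment_lagPoly (m n k l : ℕ) :
    Integrable fun w : ℂ =>
      conj w ^ m * w ^ n * lagPoly k l w * (Real.exp (-‖w‖ ^ 2) : ℂ) := by
  induction k generalizing m l with
  | zero =>
    refine (integrable_moment m (n + l)).congr (ae_of_all _ fun w => ?_)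
    simp only [lagPoly_zero_left, pow_add]; ring
  | succ k ih =>
    refine ((ih (m + 1) l).sub ((ih m (l - 1)).const_mul (l : ℂ))).congr
      (ae_of_all _ fun w => ?_)
    simp only [lagPoly_succ_left, pow_succ, Pi.sub_apply]; ring

theorem integral_moment_lagPoly (m n k l : ℕ) :
    ∫ w : ℂ, conj w ^ m * w ^ n * lagPoly k l w * (Real.exp (-‖w‖ ^ 2) : ℂ) =
      if n + l = m + k then (Real.pi * (n.factorial * m.descFactorial l : ℕ) : ℂ) else 0 := by
  induction k generalizing m l with
  | zero =>
    have h := integral_moment m (n + l)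
    rw [add_zero]
    calc _ = ∫ w : ℂ, conj w ^ m * w ^ (n + l) * (Real.exp (-‖w‖ ^ 2) : ℂ) := by
          refine integral_congr_ae (ae_of_all _ fun w => ?_)
          simp only [lagPoly_zero_left, pow_add]; ring
      _ = _ := by
          rw [h]
          split_ifs with hm
          · subst hm
            rw [← Nat.factorial_mul_descFactorial (Nat.le_add_left l n), Nat.add_sub_cancel]
          · rfl
  | succ k ih =>
    have e : ∫ w : ℂ, conj w ^ m * w ^ n * lagPoly (k + 1) l w * (Real.exp (-‖w‖ ^ 2) : ℂ) =
        (∫ w : ℂ, conj w ^ (m + 1) * w ^ n * lagPoly k l w * (Real.exp (-‖w‖ ^ 2) : ℂ)) -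
        l * ∫ w : ℂ, conj w ^ m * w ^ n * lagPoly k (l - 1) w *
          (Real.exp (-‖w‖ ^ 2) : ℂ) := by
      rw [← integral_const_mul, ← integral_sub (integrable_moment_lagPoly _ _ _ _)
        ((integrable_moment_lagPoly _ _ _ _).const_mul _)]
      refine integral_congr_ae (ae_of_all _ fun w => ?_)
      simp only [lagPoly_succ_left, pow_succ]; ring
    rw [e, ih, ih]
    rcases l with _ | l
    · simp [add_comm, add_left_comm]
    · have hc1 : n + (l + 1) = m + 1 + k ↔ n + (l + 1) = m + (k + 1) := by omega
      have hc2 : n + (l + 1 - 1) = m + k ↔ n + (l + 1) = m + (k + 1) := by omega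
      simp only [hc1, hc2]
      split_ifs with h
      -- The identity is `(m+1) - (l+1) = m - l` times a falling factorial; for `l > m` that factor
      -- is zero, so truncated subtraction does no damage.
      · rw [Nat.succ_descFactorial_succ, Nat.add_sub_cancel, Nat.descFactorial_succ]
        rcases le_or_gt l m with hl | hl
        · push_cast [Nat.cast_sub hl]; ring
        · rw [Nat.descFactorial_of_lt hl]; simp
      · simp

/-! ### The single-entry estimator -/

/-- The estimator attached to the operator `|l⟩⟨k|`. -/
noncomputable def entryEst (k l : ℕ) (η : ℝ) (z : ℂ) : ℂ :=
  1 / (η : ℂ) * Complex.exp ((1 - 1 / (η : ℂ)) * (z * star z)) *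
    (1 / (Real.sqrt (η ^ (l + k)) : ℂ) * laguerre2D l k (z / (Real.sqrt η : ℂ)))

@[fun_prop]
theorem continuous_entryEst (k l : ℕ) (η : ℝ) : Continuous (entryEst k l η) := by
  have := continuous_laguerre2D l k
  unfold entryEst
  fun_prop

theorem entryEst_swap (k l : ℕ) (η : ℝ) (z : ℂ) :
    entryEst l k η z = conj (entryEst k l η z) := by
  have hz : conj (z * star z) = z * star z := by
    rw [show star z = conj z from rfl, map_mul, Complex.conj_conj, mul_comm]
  simp only [entryEst, map_mul (starRingEnd ℂ) _ (_ * _), map_mul (starRingEnd ℂ) (1 / _) _,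
    ← Complex.exp_conj, hz, ← laguerre2D_swap]
  simp [add_comm]

theorem entryEst_sqrt_mul (k l : ℕ) {η : ℝ} (hη : 0 < η) (w : ℂ) :
    entryEst k l η (Real.sqrt η * w) =
      (Real.exp ((η - 1) * ‖w‖ ^ 2) / (η * Real.sqrt η ^ (k + l)) : ℝ) * laguerre2D l k w := by
  have h1 : (Real.sqrt η : ℂ) ≠ 0 := by exact_mod_cast (Real.sqrt_pos.2 hη).ne'
  have h0 : (η : ℂ) ≠ 0 := by exact_mod_cast hη.ne'
  have h2 : (Real.sqrt η : ℂ) * w * star ((Real.sqrt η : ℂ) * w) = η * (‖w‖ ^ 2 : ℝ) := by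
    rw [show star ((Real.sqrt η : ℂ) * w) = conj ((Real.sqrt η : ℂ) * w) from rfl,
      Complex.mul_conj', norm_mul, Complex.norm_real, Real.norm_of_nonneg (Real.sqrt_nonneg _),
      ← Complex.ofReal_pow, mul_pow, Real.sq_sqrt hη.le]
    push_cast; rfl
  have h3 : Real.sqrt (η ^ (l + k)) = Real.sqrt η ^ (k + l) := by
    rw [Real.sqrt_eq_iff_mul_self_eq (by positivity) (by positivity), ← mul_pow,
      Real.mul_self_sqrt hη.le, add_comm]
  rw [entryEst, h2, h3, mul_div_cancel_left₀ _ h1]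
  have h4 : (1 - 1 / (η : ℂ)) * (η * (‖w‖ ^ 2 : ℝ)) = (((η - 1) * ‖w‖ ^ 2 : ℝ) : ℂ) := by
    push_cast; field_simp
  rw [h4, ← Complex.ofReal_exp]
  push_cast
  field_simp

/-- In the rescaled variable the exponents `-η|w|²` and `(η-1)|w|²` add up to `-|w|²`, so `η`
survives only in the prefactor. -/
theorem moment_mul_entryEst_sqrt_mul (m n k l : ℕ) {η : ℝ} (hη : 0 < η) (w : ℂ) :
    conj (Real.sqrt η * w) ^ m * (Real.sqrt η * w) ^ n *
        (Real.exp (-‖(Real.sqrt η * w : ℂ)‖ ^ 2) : ℂ) * entryEst k l η (Real.sqrt η * w) =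
      ((Real.sqrt η ^ (m + n) / (η * Real.sqrt η ^ (k + l) *
        (Real.sqrt k.factorial * Real.sqrt l.factorial)) : ℝ) : ℂ) *
        (conj w ^ m * w ^ n * lagPoly l k w * (Real.exp (-‖w‖ ^ 2) : ℂ)) := by
  have h2 : ‖(Real.sqrt η * w : ℂ)‖ ^ 2 = η * ‖w‖ ^ 2 := by
    rw [norm_mul, Complex.norm_real, Real.norm_of_nonneg (Real.sqrt_nonneg _), mul_pow,
      Real.sq_sqrt hη.le]
  have h3 : Real.exp (-‖w‖ ^ 2) = Real.exp (-(η * ‖w‖ ^ 2)) * Real.exp ((η - 1) * ‖w‖ ^ 2) := by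
    rw [← Real.exp_add]; ring_nf
  rw [entryEst_sqrt_mul k l hη, laguerre2D_eq, h2, h3, map_mul, mul_pow, mul_pow,
    Complex.conj_ofReal]
  push_cast
  ring

theorem integrable_moment_mul_entryEst (m n k l : ℕ) {η : ℝ} (hη : 0 < η) :
    Integrable fun z : ℂ =>
      conj z ^ m * z ^ n * (Real.exp (-‖z‖ ^ 2) : ℂ) * entryEst k l η z := by
  rw [← integrable_comp_smul_iff volume _ (Real.sqrt_pos.2 hη).ne']
  simp only [Complex.real_smul, moment_mul_entryEst_sqrt_mul m n k l hη]
  exact (integrable_moment_lagPoly m n l k).const_mul _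

theorem integral_moment_mul_entryEst (m n k l : ℕ) {η : ℝ} (hη : 0 < η) :
    ∫ z : ℂ, conj z ^ m * z ^ n * (Real.exp (-‖z‖ ^ 2) : ℂ) * entryEst k l η z =
      if n + k = m + l then ((Real.pi * (Real.sqrt η ^ (m + n) / (Real.sqrt η ^ (k + l) *
        (Real.sqrt k.factorial * Real.sqrt l.factorial)) *
        (n.factorial * m.descFactorial k : ℕ)) : ℝ) : ℂ) else 0 := by
  have h := Measure.integral_comp_smul volume (fun z : ℂ =>
    conj z ^ m * z ^ n * (Real.exp (-‖z‖ ^ 2) : ℂ) * entryEst k l η z) (Real.sqrt η)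
  simp only [Complex.real_smul, moment_mul_entryEst_sqrt_mul m n k l hη] at h
  rw [integral_const_mul, integral_moment_lagPoly, Complex.finrank_real_complex,
    Real.sq_sqrt hη.le, abs_of_pos (inv_pos.2 hη)] at h
  have h0 : (η : ℂ) ≠ 0 := by exact_mod_cast hη.ne'
  have h' := congrArg (fun x => (η : ℂ) * x) h
  simp only [Complex.ofReal_inv, mul_inv_cancel_left₀ h0] at h'
  rw [← h']
  split_ifs
  · push_cast
    field_simp
  · simp

/-! ### Matrix elements -/

theorem inner_fock_left (n : ℕ) (v : Fock) : inner ℂ (fock n) v = v n := by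
  rw [fock, lp.inner_single_left]; simp

theorem inner_fock_fock (m n : ℕ) : inner ℂ (fock m) (fock n) = if m = n then (1 : ℂ) else 0 := by
  rw [inner_fock_left, fock, lp.single_apply, Pi.single_apply]

theorem matEl_ketbra_fock (a b k l : ℕ) :
    matEl (ketbra (fock a) (fock b)) k l = if k = a ∧ l = b then 1 else 0 := by
  rw [matEl, ketbra, InnerProductSpace.inner_right_rankOne_apply, inner_fock_fock, inner_fock_fock,
    ite_and]
  by_cases h : k = a <;> by_cases h' : l = b <;> simp [h, h', Ne.symm]

theorem sum_sum_ite_and {M : Type*} [AddCommMonoid M] {E a b : ℕ} (ha : a ≤ E) (hb : b ≤ E)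
    (g : ℕ → ℕ → M) :
    ∑ k ∈ Finset.range (E + 1), ∑ l ∈ Finset.range (E + 1),
      (if k = a ∧ l = b then g k l else 0) = g a b := by
  rw [Finset.sum_eq_single_of_mem a (by simp; omega)]
  · rw [Finset.sum_eq_single_of_mem b (by simp; omega)]
    · simp
    · intro l _ h; simp [h]
  · intro k _ h; simp [h]

theorem estFun_ketbra {E k l : ℕ} (hk : k ≤ E) (hl : l ≤ E) (z : ℂ) (η : ℝ) :
    estFun E (ketbra (fock l) (fock k)) z η = entryEst k l η z := by
  rw [estFun, entryEst]
  congr 1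
  rw [← sum_sum_ite_and hl hk
    (fun a b => 1 / (Real.sqrt (η ^ (a + b)) : ℂ) * laguerre2D a b (z / (Real.sqrt η : ℂ)))]
  refine Finset.sum_congr rfl fun a _ => Finset.sum_congr rfl fun b _ => ?_
  rw [matEl_ketbra_fock]
  split_ifs <;> simp

theorem constK_ketbra {E k l : ℕ} (hk : k ≤ E) (hl : l ≤ E) :
    constK E (ketbra (fock l) (fock k)) = Real.sqrt (((k : ℝ) + 1) * ((l : ℝ) + 1)) := by
  rw [constK, mul_comm,
    ← sum_sum_ite_and hl hk (fun a b : ℕ => Real.sqrt (((a : ℝ) + 1) * ((b : ℝ) + 1)))]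
  refine Finset.sum_congr rfl fun a _ => Finset.sum_congr rfl fun b _ => ?_
  rw [matEl_ketbra_fock]
  split_ifs <;> simp

/-! ### Density operators -/

theorem matEl_swap {ρ : Fock →L[ℂ] Fock} (hρ : IsDensityOperator ρ) (k l : ℕ) :
    matEl ρ l k = conj (matEl ρ k l) := by
  rw [matEl, matEl, inner_conj_symm]
  exact (hρ.isPositive.isSymmetric (fock l) (fock k)).symm

theorem matEl_self_nonneg {ρ : Fock →L[ℂ] Fock} (hρ : IsDensityOperator ρ) (k : ℕ) :
    0 ≤ (matEl ρ k k).re :=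
  hρ.isPositive.re_inner_nonneg_right (fock k)

theorem norm_matEl_le {ρ : Fock →L[ℂ] Fock} (hρ : IsDensityOperator ρ) (k l : ℕ) :
    2 * ‖matEl ρ k l‖ ≤ (matEl ρ k k).re + (matEl ρ l l).re := by
  rcases eq_or_ne (matEl ρ k l) 0 with h0 | h0
  · rw [h0, norm_zero, mul_zero]
    exact add_nonneg (matEl_self_nonneg hρ k) (matEl_self_nonneg hρ l)
  set r := matEl ρ k l with hr
  -- The phase that turns the cross terms of the quadratic form into `-2‖r‖`.
  set c : ℂ := -(conj r / ‖r‖) with hc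
  have hn : (‖r‖ : ℂ) ≠ 0 := by exact_mod_cast (norm_pos_iff.2 h0).ne'
  have h := hρ.isPositive.re_inner_nonneg_right (fock k + c • fock l)
  have e : inner ℂ (fock k + c • fock l) (ρ (fock k + c • fock l)) =
      matEl ρ k k + matEl ρ l l - 2 * ‖r‖ := by
    have h1 : conj r * r = (‖r‖ : ℂ) * ‖r‖ := by rw [Complex.conj_mul', sq]
    rw [map_add, map_smul, inner_add_left, inner_add_right, inner_add_right, inner_smul_left,
      inner_smul_left, inner_smul_right, inner_smul_right]
    change matEl ρ k k + c * r + (conj c * matEl ρ l k + conj c * (c * matEl ρ l l)) = _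
    rw [matEl_swap hρ k l, ← hr]
    have hcr : c * r = -‖r‖ := by
      rw [hc]; field_simp; linear_combination -h1
    have hcc : conj c * c = 1 := by
      rw [hc]; simp; field_simp; linear_combination h1
    have hcr' : conj c * conj r = -‖r‖ := by
      rw [← map_mul, hcr]; simp
    rw [hcr, hcr', ← mul_assoc, hcc]; ring
  rw [e] at h
  simp at h
  linarith

theorem matEl_eq_zero {E : ℕ} {ρ : Fock →L[ℂ] Fock} (hs : HasBoundedSupport E ρ) {k l : ℕ}
    (h : E < k ∨ E < l) : matEl ρ k l = 0 := by
  rw [matEl, hs, sum_apply, inner_sum]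
  refine Finset.sum_eq_zero fun a ha => ?_
  rw [sum_apply, inner_sum]
  refine Finset.sum_eq_zero fun b hb => ?_
  have h2 : inner ℂ (fock k) (ketbra (fock a) (fock b) (fock l)) = (0 : ℂ) := by
    change matEl (ketbra (fock a) (fock b)) k l = 0
    rw [matEl_ketbra_fock, if_neg]
    simp at ha hb; omega
  rw [smul_apply, inner_smul_right, h2, mul_zero]

theorem sum_matEl_self {E : ℕ} {ρ : Fock →L[ℂ] Fock} (hρ : IsDensityOperator ρ)
    (hs : HasBoundedSupport E ρ) : ∑ k ∈ Finset.range (E + 1), (matEl ρ k k).re = 1 := by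
  have h := hρ.hasSum_diag.unique (hasSum_sum_of_ne_finset_zero (s := Finset.range (E + 1))
    fun k hk => matEl_eq_zero hs (by simp at hk; omega))
  rw [← Complex.re_sum, ← h, Complex.one_re]

theorem trace_coherent {E : ℕ} {ρ : Fock →L[ℂ] Fock} (hs : HasBoundedSupport E ρ) (z : ℂ) :
    trace (ketbra (coherent z) (coherent z) ∘L ρ) =
      ∑ m ∈ Finset.range (E + 1), ∑ n ∈ Finset.range (E + 1), matEl ρ m n *
        (conj z ^ m * z ^ n * (Real.exp (-‖z‖ ^ 2) : ℂ) /
          (Real.sqrt m.factorial * Real.sqrt n.factorial)) := by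
  have hin (m : ℕ) : inner ℂ (coherent z) (fock m) =
      (Real.exp (-‖z‖ ^ 2 / 2) : ℂ) * (conj z ^ m / (Real.sqrt m.factorial : ℂ)) := by
    rw [← inner_conj_symm, inner_fock_left, coherent]
    simp [-Complex.ofReal_exp]
  have hρn (n : ℕ) : inner ℂ (coherent z) (ρ (fock n)) =
      if n ∈ Finset.range (E + 1) then ∑ m ∈ Finset.range (E + 1), matEl ρ m n *
        ((Real.exp (-‖z‖ ^ 2 / 2) : ℂ) * (conj z ^ m / (Real.sqrt m.factorial : ℂ))) else 0 := by
    conv_lhs => rw [hs]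
    rw [sum_apply, inner_sum]
    simp only [sum_apply, inner_sum, smul_apply,
      inner_smul_right, ketbra, InnerProductSpace.inner_right_rankOne_apply, inner_fock_fock, hin]
    split_ifs with hn
    · refine Finset.sum_congr rfl fun m _ => ?_
      rw [Finset.sum_eq_single_of_mem n hn]
      · simp
      · intro b _ hb; simp [hb]
    · refine Finset.sum_eq_zero fun m _ => Finset.sum_eq_zero fun b hb => ?_
      rw [if_neg (by rintro rfl; exact hn hb)]; simp
  have hexp : (Real.exp (-‖z‖ ^ 2) : ℂ) =
      (Real.exp (-‖z‖ ^ 2 / 2) : ℂ) * (Real.exp (-‖z‖ ^ 2 / 2) : ℂ) := by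
    rw [← Complex.ofReal_mul, ← Real.exp_add]; ring_nf
  have hterm (n : ℕ) : matEl (ketbra (coherent z) (coherent z) ∘L ρ) n n =
      if n ∈ Finset.range (E + 1) then ∑ m ∈ Finset.range (E + 1), matEl ρ m n *
        (conj z ^ m * z ^ n * (Real.exp (-‖z‖ ^ 2) : ℂ) /
          (Real.sqrt m.factorial * Real.sqrt n.factorial)) else 0 := by
    rw [matEl, ContinuousLinearMap.comp_apply, ketbra, InnerProductSpace.inner_right_rankOne_apply,
      hρn, inner_fock_left, coherent]
    split_ifs
    · simp only [Finset.mul_sum]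
      refine Finset.sum_congr rfl fun m _ => ?_
      rw [hexp]; field_simp
    · simp
  rw [trace, tsum_congr hterm, tsum_eq_sum (s := Finset.range (E + 1)) (fun n hn => if_neg hn),
    Finset.sum_comm]
  exact Finset.sum_congr rfl fun m hm => by rw [if_pos hm]

/-- Cyclicity of the trace, reduced to finite sums by the bounded support. This form exhibits the
Husimi function as real and nonnegative. -/
theorem trace_coherent_eq_inner {E : ℕ} {ρ : Fock →L[ℂ] Fock} (hs : HasBoundedSupport E ρ)
    (z : ℂ) : trace (ketbra (coherent z) (coherent z) ∘L ρ) =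
      inner ℂ (coherent z) (ρ (coherent z)) := by
  have hterm (n : ℕ) : matEl (ketbra (coherent z) (coherent z) ∘L ρ) n n =
      inner ℂ (fock n) (coherent z) * inner ℂ (coherent z) (ρ (fock n)) := by
    rw [matEl, ContinuousLinearMap.comp_apply, ketbra, InnerProductSpace.inner_right_rankOne_apply]
  have hz (n : ℕ) (hn : n ∉ Finset.range (E + 1)) : ρ (fock n) = 0 := by
    rw [hs]
    simp only [sum_apply, smul_apply, ketbra,
      InnerProductSpace.rankOne_apply, inner_fock_fock]
    refine Finset.sum_eq_zero fun m _ => Finset.sum_eq_zero fun b hb => ?_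
    rw [if_neg (by rintro rfl; exact hn hb)]; simp
  have hρv (v : Fock) : ρ v = ∑ n ∈ Finset.range (E + 1), inner ℂ (fock n) v • ρ (fock n) := by
    conv_lhs => rw [hs]
    conv_rhs => rw [hs]
    simp only [sum_apply, smul_apply, ketbra,
      InnerProductSpace.rankOne_apply, inner_fock_fock, Finset.smul_sum]
    rw [Finset.sum_comm' (t' := Finset.range (E + 1)) (s' := fun _ => Finset.range (E + 1))
      (by simp)]
    refine Finset.sum_congr rfl fun n hn => ?_
    refine Finset.sum_congr rfl fun m _ => ?_
    rw [Finset.sum_eq_single_of_mem n hn (fun b _ hb => by simp [hb])]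
    simp [smul_smul, mul_comm]
  rw [trace, tsum_congr hterm, tsum_eq_sum (s := Finset.range (E + 1))
    (fun n hn => by rw [hz n hn]; simp), hρv (coherent z), inner_sum]
  exact Finset.sum_congr rfl fun n _ => by rw [inner_smul_right]

theorem husimiQ_nonneg {E : ℕ} {ρ : Fock →L[ℂ] Fock} (hρ : IsDensityOperator ρ)
    (hs : HasBoundedSupport E ρ) (z : ℂ) : 0 ≤ husimiQ ρ z := by
  rw [husimiQ, trace_coherent_eq_inner hs]
  exact mul_nonneg (by positivity) (hρ.isPositive.re_inner_nonneg_right _)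

theorem ofReal_husimiQ {E : ℕ} {ρ : Fock →L[ℂ] Fock} (hρ : IsDensityOperator ρ)
    (hs : HasBoundedSupport E ρ) (z : ℂ) :
    (husimiQ ρ z : ℂ) = 1 / Real.pi *
      ∑ m ∈ Finset.range (E + 1), ∑ n ∈ Finset.range (E + 1), matEl ρ m n *
        (conj z ^ m * z ^ n * (Real.exp (-‖z‖ ^ 2) : ℂ) /
          (Real.sqrt m.factorial * Real.sqrt n.factorial)) := by
  rw [← trace_coherent hs, husimiQ]
  have : ((trace (ketbra (coherent z) (coherent z) ∘L ρ)).re : ℂ) =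
      trace (ketbra (coherent z) (coherent z) ∘L ρ) := by
    rw [trace_coherent_eq_inner hs, ← Complex.conj_eq_iff_re, inner_conj_symm]
    exact hρ.isPositive.isSymmetric _ _
  push_cast
  rw [this]

theorem measurable_husimiQ {E : ℕ} {ρ : Fock →L[ℂ] Fock} (hs : HasBoundedSupport E ρ) :
    Measurable (husimiQ ρ) := by
  unfold husimiQ
  simp only [trace_coherent hs]
  refine Continuous.measurable ?_
  simp only [div_eq_mul_inv]
  fun_prop

theorem integral_heterodyneLaw {E : ℕ} {ρ : Fock →L[ℂ] Fock} (hρ : IsDensityOperator ρ)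
    (hs : HasBoundedSupport E ρ) (g : ℂ → ℂ) :
    ∫ z, g z ∂(heterodyneLaw ρ) = ∫ z, (husimiQ ρ z : ℂ) * g z := by
  rw [heterodyneLaw, integral_withDensity_eq_integral_toReal_smul
    (measurable_husimiQ hs).ennreal_ofReal (ae_of_all _ fun _ => ENNReal.ofReal_lt_top)]
  refine integral_congr_ae (ae_of_all _ fun z => ?_)
  simp only [ENNReal.toReal_ofReal (husimiQ_nonneg hρ hs z), Complex.real_smul]

/-- The coefficient of `ρ_{mn}` in the mean of the estimator of `ρ_{kl}`. -/
noncomputable def meanCoeff (k l : ℕ) (η : ℝ) (m n : ℕ) : ℝ :=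
  if n + k = m + l then
    Real.sqrt η ^ (m + n) / (Real.sqrt η ^ (k + l) *
      (Real.sqrt k.factorial * Real.sqrt l.factorial)) * (n.factorial * m.descFactorial k : ℕ) /
      (Real.sqrt m.factorial * Real.sqrt n.factorial)
  else 0

theorem integral_entryEst {E : ℕ} {ρ : Fock →L[ℂ] Fock} (hρ : IsDensityOperator ρ)
    (hs : HasBoundedSupport E ρ) (k l : ℕ) {η : ℝ} (hη : 0 < η) :
    ∫ z, entryEst k l η z ∂(heterodyneLaw ρ) =
      ∑ m ∈ Finset.range (E + 1), ∑ n ∈ Finset.range (E + 1),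
        matEl ρ m n * (meanCoeff k l η m n : ℂ) := by
  rw [integral_heterodyneLaw hρ hs]
  have e : (fun z => (husimiQ ρ z : ℂ) * entryEst k l η z) = fun z =>
      ∑ m ∈ Finset.range (E + 1), ∑ n ∈ Finset.range (E + 1),
        (1 / Real.pi * matEl ρ m n / (Real.sqrt m.factorial * Real.sqrt n.factorial)) *
        (conj z ^ m * z ^ n * (Real.exp (-‖z‖ ^ 2) : ℂ) * entryEst k l η z) := by
    ext z
    rw [ofReal_husimiQ hρ hs, Finset.mul_sum, Finset.sum_mul]
    refine Finset.sum_congr rfl fun m _ => ?_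
    rw [Finset.mul_sum, Finset.sum_mul]
    refine Finset.sum_congr rfl fun n _ => ?_
    ring
  have hi (m n : ℕ) := integrable_moment_mul_entryEst m n k l hη
  rw [e, integral_finsetSum _ fun m _ => integrable_finsetSum _ fun n _ => (hi m n).const_mul _]
  refine Finset.sum_congr rfl fun m _ => ?_
  rw [integral_finsetSum _ fun n _ => (hi m n).const_mul _]
  refine Finset.sum_congr rfl fun n _ => ?_
  rw [integral_const_mul, integral_moment_mul_entryEst m n k l hη, meanCoeff]
  have hpi : (Real.pi : ℂ) ≠ 0 := by exact_mod_cast Real.pi_ne_zero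
  split_ifs
  · push_cast
    field_simp
  · simp

/-! ### Bias of the estimator -/

/-- Passing from `p` to `p + 1` multiplies the binomial by `(k+p+1)/(p+1)`, which is at most `k +
1`. -/
theorem choose_add_le_pow (k p : ℕ) : (k + p).choose k ≤ (k + 1) ^ p := by
  induction p with
  | zero => simp
  | succ p ih =>
    have h := Nat.add_one_mul_choose_eq (k + p) p
    rw [Nat.choose_symm_add] at ih
    rw [Nat.choose_symm_add]
    refine Nat.le_of_mul_le_mul_right (c := p + 1) ?_ p.succ_pos
    have h' : (k + (p + 1)).choose (p + 1) * (p + 1) = (k + p + 1) * (k + p).choose p := h.symm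
    rw [h']
    calc (k + p + 1) * (k + p).choose p ≤ ((k + 1) * (p + 1)) * (k + 1) ^ p :=
          Nat.mul_le_mul (by nlinarith) ih
      _ = _ := by ring

theorem meanCoeff_add (k l p : ℕ) {η : ℝ} (hη : 0 < η) :
    meanCoeff k l η (k + p) (l + p) =
      η ^ p * (Real.sqrt ((k + p).choose k) * Real.sqrt ((l + p).choose l)) := by
  have hdesc (a : ℕ) : ((a + p).descFactorial a : ℝ) =
      Real.sqrt a.factorial ^ 2 * Real.sqrt ((a + p).choose a) ^ 2 := by
    rw [Real.sq_sqrt (by positivity), Real.sq_sqrt (by positivity),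
      Nat.descFactorial_eq_factorial_mul_choose]; push_cast; rfl
  have hfac (a : ℕ) : Real.sqrt (a + p).factorial = Real.sqrt ((a + p).choose a) *
      Real.sqrt a.factorial * Real.sqrt p.factorial := by
    rw [← Real.sqrt_mul (by positivity), ← Real.sqrt_mul (by positivity),
      ← Nat.add_choose_mul_factorial_mul_factorial, Nat.choose_symm_add]; push_cast; rfl
  have hpos (a : ℕ) : Real.sqrt a.factorial ≠ 0 := (Real.sqrt_pos.2 (by positivity)).ne'
  have hcpos (a : ℕ) : Real.sqrt ((a + p).choose a) ≠ 0 :=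
    (Real.sqrt_pos.2 (by exact_mod_cast Nat.choose_pos (Nat.le_add_right a p))).ne'
  have hs : Real.sqrt η ≠ 0 := (Real.sqrt_pos.2 hη).ne'
  have hη2 : η ^ p = Real.sqrt η ^ (2 * p) := by rw [pow_mul, Real.sq_sqrt hη.le]
  have hf2 : ((l + p).factorial : ℝ) = (Real.sqrt ((l + p).choose l) *
      Real.sqrt l.factorial * Real.sqrt p.factorial) ^ 2 := by
    rw [← hfac, Real.sq_sqrt (by positivity)]
  rw [meanCoeff, if_pos (by ring), Nat.cast_mul, hdesc, hfac k, hfac l, hf2, hη2,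
    show k + p + (l + p) = k + l + 2 * p by ring, pow_add (Real.sqrt η)]
  have h1 := hpos k; have h2 := hpos l; have h3 := hpos p
  have h4 := hcpos k; have h5 := hcpos l
  field_simp

theorem meanCoeff_self (k l : ℕ) {η : ℝ} (hη : 0 < η) : meanCoeff k l η k l = 1 := by
  simpa using meanCoeff_add k l 0 hη

theorem abs_meanCoeff_add_le (k l p : ℕ) {ε : ℝ} (hε : 0 < ε) :
    |meanCoeff k l (ε / Real.sqrt (((k : ℝ) + 1) * ((l : ℝ) + 1))) (k + p) (l + p)| ≤ ε ^ p := by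
  have hK : 0 < Real.sqrt (((k : ℝ) + 1) * ((l : ℝ) + 1)) := Real.sqrt_pos.2 (by positivity)
  have hch (a : ℕ) : Real.sqrt ((a + p).choose a) ≤ Real.sqrt ((a : ℝ) + 1) ^ p := by
    rw [Real.sqrt_le_left (by positivity), ← pow_mul, mul_comm, pow_mul,
      Real.sq_sqrt (by positivity)]
    exact_mod_cast choose_add_le_pow a p
  rw [meanCoeff_add k l p (by positivity), abs_of_nonneg (by positivity)]
  calc _ ≤ (ε / Real.sqrt (((k : ℝ) + 1) * ((l : ℝ) + 1))) ^ p *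
        (Real.sqrt ((k : ℝ) + 1) ^ p * Real.sqrt ((l : ℝ) + 1) ^ p) := by
        gcongr
        · exact hch k
        · exact hch l
    _ = ε ^ p := by
        rw [← mul_pow, ← Real.sqrt_mul (by positivity), ← mul_pow, div_mul_cancel₀ _ hK.ne']

theorem abs_meanCoeff_le (k l m n : ℕ) {ε : ℝ} (hε : 0 < ε) (hε1 : ε < 1)
    (h : ¬(m = k ∧ n = l)) :
    |meanCoeff k l (ε / Real.sqrt (((k : ℝ) + 1) * ((l : ℝ) + 1))) m n| ≤
      if n + k = m + l then ε else 0 := by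
  split_ifs with hc
  -- Below `(k, l)` on the diagonal the falling factorial vanishes; above it, `p ≥ 1` gives `ε^p ≤
  -- ε`.
  · rcases lt_or_ge m k with hm | hm
    · rw [meanCoeff, if_pos hc, Nat.descFactorial_of_lt hm]
      simpa using hε.le
    · obtain ⟨p, rfl⟩ := Nat.exists_eq_add_of_le hm
      obtain rfl : n = l + p := by omega
      have hp : p ≠ 0 := by rintro rfl; simp at h
      exact (abs_meanCoeff_add_le k l p hε).trans (pow_le_of_le_one hε.le hε1.le hp)
  · rw [meanCoeff, if_neg hc, abs_zero]

theorem sum_ite_le_of_unique {s : Finset ℕ} {p : ℕ → Prop} [DecidablePred p]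
    (hp : ∀ a b, p a → p b → a = b) {x : ℝ} (hx : 0 ≤ x) :
    ∑ n ∈ s, (if p n then x else 0) ≤ x := by
  by_cases h : ∃ a ∈ s, p a
  · obtain ⟨a, ha, hpa⟩ := h
    rw [Finset.sum_eq_single_of_mem a ha fun b _ hb => if_neg fun hpb => hb (hp b a hpb hpa),
      if_pos hpa]
  · push Not at h
    rw [Finset.sum_eq_zero fun n hn => if_neg (h n hn)]
    exact hx

theorem norm_matEl_sub_integral_entryEst_le {E k l : ℕ} (hk : k ≤ E) (hl : l ≤ E)
    {ρ : Fock →L[ℂ] Fock} (hρ : IsDensityOperator ρ) (hs : HasBoundedSupport E ρ) {ε : ℝ}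
    (hε : 0 < ε) (hε1 : ε < 1) :
    ‖matEl ρ k l - ∫ z, entryEst k l (ε / Real.sqrt (((k : ℝ) + 1) * ((l : ℝ) + 1))) z
      ∂(heterodyneLaw ρ)‖ ≤ ε := by
  set η := ε / Real.sqrt (((k : ℝ) + 1) * ((l : ℝ) + 1)) with hηdef
  have hη : 0 < η := div_pos hε (Real.sqrt_pos.2 (by positivity))
  rw [integral_entryEst hρ hs k l hη, ← sum_sum_ite_and hk hl (fun m n => matEl ρ m n),
    ← Finset.sum_sub_distrib]
  simp only [← Finset.sum_sub_distrib]
  -- Replacing `|ρ_{mn}|` by the mean of two diagonal entries leaves two sums, each at most the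
  -- trace because every row and column meets the diagonal at most once.
  have hterm (m n : ℕ) :
      ‖(if m = k ∧ n = l then matEl ρ m n else 0) - matEl ρ m n * (meanCoeff k l η m n : ℂ)‖ ≤
        ε / 2 * ((if n + k = m + l then (matEl ρ m m).re else 0) +
          (if n + k = m + l then (matEl ρ n n).re else 0)) := by
    by_cases h : m = k ∧ n = l
    · rw [if_pos h, h.1, h.2, meanCoeff_self k l hη, Complex.ofReal_one, mul_one, sub_self,
        norm_zero, if_pos (add_comm l k), if_pos (add_comm l k)]
      have := matEl_self_nonneg hρ k
      have := matEl_self_nonneg hρ l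
      positivity
    · rw [if_neg h, zero_sub, norm_neg, norm_mul, Complex.norm_real, Real.norm_eq_abs]
      refine (mul_le_mul_of_nonneg_left (abs_meanCoeff_le k l m n hε hε1 h)
        (norm_nonneg _)).trans ?_
      split_ifs
      · nlinarith [norm_matEl_le hρ m n]
      · simp
  refine (norm_sum_le _ _).trans ((Finset.sum_le_sum fun m _ => (norm_sum_le _ _).trans
    (Finset.sum_le_sum fun n _ => hterm m n)).trans ?_)
  simp only [← Finset.mul_sum, Finset.sum_add_distrib]
  have h1 : ∑ m ∈ Finset.range (E + 1), ∑ n ∈ Finset.range (E + 1),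
      (if n + k = m + l then (matEl ρ m m).re else 0) ≤ 1 := by
    rw [← sum_matEl_self hρ hs]
    exact Finset.sum_le_sum fun m _ =>
      sum_ite_le_of_unique (fun a b _ _ => by omega) (matEl_self_nonneg hρ m)
  have h2 : ∑ m ∈ Finset.range (E + 1), ∑ n ∈ Finset.range (E + 1),
      (if n + k = m + l then (matEl ρ n n).re else 0) ≤ 1 := by
    rw [← sum_matEl_self hρ hs, Finset.sum_comm]
    exact Finset.sum_le_sum fun n _ =>
      sum_ite_le_of_unique (fun a b _ _ => by omega) (matEl_self_nonneg hρ n)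
  nlinarith

/-! ### Uniform bound on the estimator -/

/-- Bounding the monomial by `2^l e^{|w|²/2}` needs `2(η-1) + 1/2 ≤ 0`, whence `3/4`. -/
theorem exp_mul_norm_sq_laguerre2D_zero_left_le (l : ℕ) (w : ℂ) {η : ℝ} (hη : η ≤ 3 / 4) :
    Real.exp (2 * ((η - 1) * ‖w‖ ^ 2)) * ‖laguerre2D 0 l w‖ ^ 2 ≤ 2 ^ l := by
  have h1 : ‖laguerre2D 0 l w‖ ^ 2 = 2 ^ l * ((‖w‖ ^ 2 / 2) ^ l / l.factorial) := by
    rw [laguerre2D_zero_left, norm_div, div_pow, Complex.norm_real,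
      Real.norm_of_nonneg (Real.sqrt_nonneg _), Real.sq_sqrt (by positivity), norm_pow, div_pow,
      ← pow_mul, ← pow_mul, mul_comm l 2]
    field_simp
  have h2 := Real.pow_div_factorial_le_exp (x := ‖w‖ ^ 2 / 2) (by positivity) l
  rw [h1]
  calc _ ≤ Real.exp (2 * ((η - 1) * ‖w‖ ^ 2)) * (2 ^ l * Real.exp (‖w‖ ^ 2 / 2)) := by gcongr
    _ = 2 ^ l * Real.exp (2 * ((η - 1) * ‖w‖ ^ 2) + ‖w‖ ^ 2 / 2) := by
        rw [Real.exp_add]; ring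
    _ ≤ 2 ^ l * 1 := by
        gcongr
        rw [Real.exp_le_one_iff]
        nlinarith [sq_nonneg ‖w‖]
    _ = 2 ^ l := mul_one _

theorem exp_mul_norm_sq_laguerre2D_le_one (k l : ℕ) (w : ℂ) {η : ℝ} (hη : η ≤ 1 / 2) :
    Real.exp (2 * ((η - 1) * ‖w‖ ^ 2)) * ‖laguerre2D k l w‖ ^ 2 ≤ 1 := by
  calc _ ≤ Real.exp (2 * ((η - 1) * ‖w‖ ^ 2)) * Real.exp (‖w‖ ^ 2) := by
        gcongr; exact norm_sq_laguerre2D_le k l w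
    _ = Real.exp (2 * ((η - 1) * ‖w‖ ^ 2) + ‖w‖ ^ 2) := (Real.exp_add _ _).symm
    _ ≤ 1 := by
        rw [Real.exp_le_one_iff]
        nlinarith [sq_nonneg ‖w‖]

theorem div_sqrt_le {x ε c : ℝ} (hε1 : ε < 1) (hc : 0 < c) (hx : 1 / c ^ 2 ≤ x) :
    ε / Real.sqrt x ≤ c := by
  have h1 : 1 / c ≤ Real.sqrt x := by
    refine Real.le_sqrt_of_sq_le ?_
    rwa [div_pow, one_pow]
  have h2 : 0 < 1 / c := by positivity
  rw [div_le_iff₀ (h2.trans_le h1)]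
  calc ε ≤ c * (1 / c) := by rw [mul_one_div_cancel hc.ne']; exact hε1.le
    _ ≤ c * Real.sqrt x := by gcongr

/-- For `k, l ≥ 1` the square root is at least 2, so `η ≤ 1/2` and unitarity gives the bound 1. If
exactly one index is 0, it is at least `√2`, so `η ≤ 3/4` and the monomial bound applies. If both
are 0, `η < 1` suffices. -/
theorem exp_mul_norm_sq_laguerre2D_le (k l : ℕ) (w : ℂ) {ε : ℝ} (hε1 : ε < 1) :
    Real.exp (2 * ((ε / Real.sqrt (((k : ℝ) + 1) * ((l : ℝ) + 1)) - 1) * ‖w‖ ^ 2)) *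
        ‖laguerre2D l k w‖ ^ 2 ≤
      (2 : ℝ) ^ ((l : ℤ) - (k : ℤ)).natAbs * ((max k l).choose (min k l) : ℝ) := by
  have hC : (1 : ℝ) ≤ ((max k l).choose (min k l) : ℝ) := by
    exact_mod_cast Nat.choose_pos (min_le_max)
  rcases Nat.eq_zero_or_pos k with rfl | hk <;> rcases Nat.eq_zero_or_pos l with rfl | hl
  · simp [laguerre2D_zero_left]
    nlinarith [sq_nonneg ‖w‖]
  · have hl' : (1 : ℝ) ≤ l := by exact_mod_cast hl
    rw [laguerre2D_swap, Complex.norm_conj]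
    refine (exp_mul_norm_sq_laguerre2D_zero_left_le l w (div_sqrt_le hε1 (by norm_num) ?_)).trans ?_
    · norm_num; linarith
    · simp
  · have hk' : (1 : ℝ) ≤ k := by exact_mod_cast hk
    refine (exp_mul_norm_sq_laguerre2D_zero_left_le k w (div_sqrt_le hε1 (by norm_num) ?_)).trans ?_
    · norm_num; linarith
    · simp
  · have hl' : (1 : ℝ) ≤ l := by exact_mod_cast hl
    have hk' : (1 : ℝ) ≤ k := by exact_mod_cast hk
    refine (exp_mul_norm_sq_laguerre2D_le_one l k w (div_sqrt_le hε1 (by norm_num) ?_)).trans ?_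
    · norm_num; nlinarith
    · exact one_le_mul_of_one_le_of_one_le (one_le_pow₀ (by norm_num)) hC

theorem constC_pos (k l : ℕ) : 0 < constC k l := by
  have : 0 < ((max k l).choose (min k l) : ℝ) := by
    exact_mod_cast Nat.choose_pos (min_le_max)
  rw [constC]
  positivity

theorem norm_sq_entryEst_le (k l : ℕ) {ε : ℝ} (hε : 0 < ε) (hε1 : ε < 1) (z : ℂ) :
    ‖entryEst k l (ε / Real.sqrt (((k : ℝ) + 1) * ((l : ℝ) + 1))) z‖ ^ 2 ≤
      constC k l / ε ^ (2 + k + l) := by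
  set x : ℝ := ((k : ℝ) + 1) * ((l : ℝ) + 1) with hx
  have hx0 : 0 < x := by positivity
  set η := ε / Real.sqrt x with hηdef
  have hη : 0 < η := div_pos hε (Real.sqrt_pos.2 hx0)
  have h1 : (Real.sqrt η : ℂ) ≠ 0 := by exact_mod_cast (Real.sqrt_pos.2 hη).ne'
  obtain ⟨w, rfl⟩ : ∃ w : ℂ, z = Real.sqrt η * w := ⟨z / Real.sqrt η, by field_simp⟩
  have h := exp_mul_norm_sq_laguerre2D_le k l w hε1
  rw [← hx, ← hηdef] at h
  have hpow : (η * Real.sqrt η ^ (k + l)) ^ 2 = η ^ (2 + k + l) := by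
    rw [mul_pow, ← pow_mul, mul_comm (k + l), pow_mul, Real.sq_sqrt hη.le]; ring
  -- This power of `x` in `constC` is the denominator of `η ^ (2 + k + l)`.
  have hrp : x ^ (1 + ((k : ℝ) + (l : ℝ)) / 2) = Real.sqrt x ^ (2 + k + l) := by
    rw [Real.sqrt_eq_rpow, ← Real.rpow_natCast, ← Real.rpow_mul hx0.le]
    congr 1; push_cast; ring
  have hexp : Real.exp ((η - 1) * ‖w‖ ^ 2) ^ 2 = Real.exp (2 * ((η - 1) * ‖w‖ ^ 2)) := by
    rw [← Real.exp_nat_mul]; norm_num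
  rw [entryEst_sqrt_mul k l hη, norm_mul, Complex.norm_real, Real.norm_of_nonneg (by positivity),
    mul_pow, div_pow, hpow, hexp, constC, ← hx, hrp, div_mul_eq_mul_div, hηdef, div_pow,
    div_div_eq_mul_div, ← hηdef, mul_assoc (Real.sqrt x ^ _), mul_comm (Real.sqrt x ^ _)]
  gcongr

/-! ### Concentration -/

/-- Hoeffding's lemma on `[-M, M]` gives each centred sample variance proxy `M²`; the 2 counts the
two tails. -/
theorem measureReal_abs_integral_sub_mean_ge_le {Ω : Type*} [MeasurableSpace Ω] {P : Measure Ω}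
    [IsProbabilityMeasure P] {n : ℕ} (hn : 1 ≤ n) {μ : Measure ℂ} {α : Fin n → Ω → ℂ}
    (hindep : iIndepFun α P) (hlaw : ∀ i, HasLaw (α i) μ P) {u : ℂ → ℝ} (hu : Continuous u)
    {M : ℝ} (hM : 0 < M) (hb : ∀ z, |u z| ≤ M) {t : ℝ} (ht : 0 ≤ t) :
    P.real {ω | t ≤ |(∫ z, u z ∂μ) - 1 / n * ∑ i, u (α i ω)|} ≤
      2 * Real.exp (-(n * t ^ 2 / (2 * M ^ 2))) := by
  have hn0 : (0 : ℝ) < n := by exact_mod_cast hn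
  have hum : ∀ i, AEMeasurable (fun ω => u (α i ω)) P := fun i =>
    hu.measurable.comp_aemeasurable (hlaw i).aemeasurable
  have hmean : ∀ i, ∫ ω, u (α i ω) ∂P = ∫ z, u z ∂μ := fun i =>
    (hlaw i).integral_comp hu.aestronglyMeasurable
  have hsub : ∀ i, HasSubgaussianMGF (fun ω => u (α i ω) - ∫ z, u z ∂μ)
      ((‖M - -M‖₊ / 2) ^ 2) P := fun i => by
    rw [← hmean i]
    exact hasSubgaussianMGF_of_mem_Icc (hum i) (ae_of_all _ fun ω => abs_le.1 (hb _))
  have hind : iIndepFun (fun i ω => u (α i ω) - ∫ z, u z ∂μ) P :=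
    hindep.comp (fun _ z => u z - ∫ z, u z ∂μ) fun _ => (hu.sub continuous_const).measurable
  have hind' : iIndepFun (fun i ω => -(u (α i ω) - ∫ z, u z ∂μ)) P :=
    hindep.comp (fun _ z => -(u z - ∫ z, u z ∂μ)) fun _ => (hu.sub continuous_const).neg.measurable
  have hparam : ((∑ _i : Fin n, (‖M - -M‖₊ / 2) ^ 2 : NNReal) : ℝ) = n * M ^ 2 := by
    have : ‖M - -M‖ = 2 * M := by
      rw [Real.norm_of_nonneg (by linarith)]; ring
    simp only [NNReal.coe_sum, NNReal.coe_pow, NNReal.coe_div, coe_nnnorm, this]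
    simp
  have hexp : -(n * t) ^ 2 / (2 * ((∑ _i : Fin n, (‖M - -M‖₊ / 2) ^ 2 : NNReal) : ℝ)) =
      -(n * t ^ 2 / (2 * M ^ 2)) := by
    rw [hparam]; field_simp
  have hnt : 0 ≤ n * t := by positivity
  have h1 := HasSubgaussianMGF.measure_sum_ge_le_of_iIndepFun hind (s := Finset.univ)
    (fun i _ => hsub i) hnt
  have h2 := HasSubgaussianMGF.measure_sum_ge_le_of_iIndepFun hind' (s := Finset.univ)
    (fun i _ => (hsub i).neg) hnt
  rw [hexp] at h1 h2
  refine (measureReal_mono (s₂ := {ω | n * t ≤ ∑ i, (u (α i ω) - ∫ z, u z ∂μ)} ∪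
    {ω | n * t ≤ ∑ i, -(u (α i ω) - ∫ z, u z ∂μ)}) ?_).trans
      ((measureReal_union_le _ _).trans (by linarith))
  intro ω hω
  simp only [Set.mem_ofPred_eq, Set.mem_union, Finset.sum_neg_distrib, Finset.sum_sub_distrib,
    Finset.sum_const, Finset.card_univ, Fintype.card_fin, nsmul_eq_mul] at hω ⊢
  have key : n * ((∫ z, u z ∂μ) - 1 / n * ∑ i, u (α i ω)) =
      n * (∫ z, u z ∂μ) - ∑ i, u (α i ω) := by field_simp
  rcases le_abs.1 hω with h | h
  · right; nlinarith
  · left; nlinarith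

theorem le_abs_re_or_le_abs_im {z : ℂ} {t : ℝ} (h : t < ‖z‖) :
    t / Real.sqrt 2 ≤ |z.re| ∨ t / Real.sqrt 2 ≤ |z.im| := by
  by_contra! hc
  have h2 : 0 < Real.sqrt 2 := by positivity
  have := Complex.norm_le_sqrt_two_mul_max z
  have h3 : max |z.re| |z.im| < t / Real.sqrt 2 := max_lt hc.1 hc.2
  have h4 := mul_lt_mul_of_pos_left h3 h2
  rw [mul_div_cancel₀ _ h2.ne'] at h4
  linarith

section Concentration

variable {Ω : Type*} {n : ℕ} {μ : Measure ℂ} {α : Fin n → Ω → ℂ} {g : ℂ → ℂ} {M t : ℝ}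

theorem integrable_of_norm_le [IsFiniteMeasure μ] (hg : Continuous g) (hb : ∀ z, ‖g z‖ ≤ M) :
    Integrable g μ :=
  Integrable.of_bound hg.aestronglyMeasurable M (ae_of_all _ hb)

theorem re_integral_sub_mean (hi : Integrable g μ) (ω : Ω) :
    ((∫ z, g z ∂μ) - 1 / (n : ℂ) * ∑ i, g (α i ω)).re =
      (∫ z, (g z).re ∂μ) - 1 / n * ∑ i, (g (α i ω)).re := by
  have h1 := Complex.reCLM.integral_comp_comm hi
  simp only [Complex.reCLM_apply] at h1
  have h2 : (1 / (n : ℂ)) = ((1 / n : ℝ) : ℂ) := by push_cast; rfl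
  rw [Complex.sub_re, h1, h2, Complex.re_ofReal_mul, Complex.re_sum]

theorem im_integral_sub_mean (hi : Integrable g μ) (ω : Ω) :
    ((∫ z, g z ∂μ) - 1 / (n : ℂ) * ∑ i, g (α i ω)).im =
      (∫ z, (g z).im ∂μ) - 1 / n * ∑ i, (g (α i ω)).im := by
  have h1 := Complex.imCLM.integral_comp_comm hi
  simp only [Complex.imCLM_apply] at h1
  have h2 : (1 / (n : ℂ)) = ((1 / n : ℝ) : ℂ) := by push_cast; rfl
  rw [Complex.sub_im, h1, h2, Complex.im_ofReal_mul, Complex.im_sum]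

variable [MeasurableSpace Ω] {P : Measure Ω} [IsProbabilityMeasure P]

theorem measureReal_norm_integral_sub_mean_gt_le (hn : 1 ≤ n) (hindep : iIndepFun α P)
    (hlaw : ∀ i, HasLaw (α i) μ P) (hg : Continuous g) (hM : 0 < M) (hb : ∀ z, ‖g z‖ ≤ M)
    (ht : 0 < t) :
    P.real {ω | t < ‖(∫ z, g z ∂μ) - 1 / (n : ℂ) * ∑ i, g (α i ω)‖} ≤
      4 * Real.exp (-(n * t ^ 2 / (4 * M ^ 2))) := by
  -- `μ` is a probability measure because it is the law of a sample, which exists as `n ≥ 1`.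
  have := (hlaw ⟨0, hn⟩).isProbabilityMeasure_iff.1 inferInstance
  have hi : Integrable g μ := integrable_of_norm_le hg hb
  have h1 := measureReal_abs_integral_sub_mean_ge_le hn hindep hlaw
    (Complex.continuous_re.comp hg) hM (fun z => (Complex.abs_re_le_norm _).trans (hb z))
    (t := t / Real.sqrt 2) (by positivity)
  have h2 := measureReal_abs_integral_sub_mean_ge_le hn hindep hlaw
    (Complex.continuous_im.comp hg) hM (fun z => (Complex.abs_im_le_norm _).trans (hb z))
    (t := t / Real.sqrt 2) (by positivity)
  have e : n * (t / Real.sqrt 2) ^ 2 / (2 * M ^ 2) = n * t ^ 2 / (4 * M ^ 2) := by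
    rw [div_pow, Real.sq_sqrt (by norm_num)]; field_simp; norm_num
  rw [e] at h1 h2
  refine (measureReal_mono (s₂ := _ ∪ _) fun ω hω => ?_).trans
    ((measureReal_union_le _ _).trans ((add_le_add h1 h2).trans (by linarith)))
  have := le_abs_re_or_le_abs_im hω
  rwa [re_integral_sub_mean hi, im_integral_sub_mean hi] at this

/-- The event for the imaginary part is empty, so 2 replaces 4 in the bound; this is the source of
strictness in the final theorem. -/
theorem measureReal_norm_integral_sub_mean_gt_lt_of_real (hn : 1 ≤ n) (hindep : iIndepFun α P)
    (hlaw : ∀ i, HasLaw (α i) μ P) (hg : Continuous g) (hM : 0 < M) (hb : ∀ z, ‖g z‖ ≤ M)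
    (ht : 0 < t) (hreal : ∀ z, (g z).im = 0) :
    P.real {ω | t < ‖(∫ z, g z ∂μ) - 1 / (n : ℂ) * ∑ i, g (α i ω)‖} <
      4 * Real.exp (-(n * t ^ 2 / (4 * M ^ 2))) := by
  have := (hlaw ⟨0, hn⟩).isProbabilityMeasure_iff.1 inferInstance
  have hi : Integrable g μ := integrable_of_norm_le hg hb
  have h1 := measureReal_abs_integral_sub_mean_ge_le hn hindep hlaw
    (Complex.continuous_re.comp hg) hM (fun z => (Complex.abs_re_le_norm _).trans (hb z))
    (t := t / Real.sqrt 2) (by positivity)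
  have e : n * (t / Real.sqrt 2) ^ 2 / (2 * M ^ 2) = n * t ^ 2 / (4 * M ^ 2) := by
    rw [div_pow, Real.sq_sqrt (by norm_num)]; field_simp; norm_num
  rw [e] at h1
  refine (measureReal_mono (fun ω hω => ?_)).trans_lt (h1.trans_lt ?_)
  · have := le_abs_re_or_le_abs_im hω
    rw [re_integral_sub_mean hi, im_integral_sub_mean hi] at this
    simp only [hreal, integral_zero, Finset.sum_const_zero, mul_zero, sub_zero, abs_zero] at this
    refine this.resolve_right (not_le.2 (by positivity))
  · linarith [Real.exp_pos (-(n * t ^ 2 / (4 * M ^ 2)))]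

end Concentration

/-! ### Combining bias and concentration by a union bound -/

theorem estimate_eq {E n k l : ℕ} (hk : k ≤ E) (hl : l ≤ E) (ε : ℝ) (α : Fin n → ℂ) :
    estimate E ε α k l = 1 / (n : ℂ) * ∑ i,
      entryEst k l (ε / Real.sqrt (((k : ℝ) + 1) * ((l : ℝ) + 1))) (α i) := by
  simp only [estimate, constK_ketbra hk hl, estFun_ketbra hk hl]

theorem estimate_swap {E n k l : ℕ} (hk : k ≤ E) (hl : l ≤ E) (ε : ℝ) (α : Fin n → ℂ) :
    estimate E ε α l k = conj (estimate E ε α k l) := by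
  rw [estimate_eq hl hk, estimate_eq hk hl, map_mul, map_sum]
  simp [entryEst_swap k l, mul_comm]

end Heterodyne

open Heterodyne in
theorem theorem2 {Ω : Type*} [MeasurableSpace Ω] (P : Measure Ω) [IsProbabilityMeasure P]
    (E n : ℕ) (hn : 1 ≤ n) (ε ε' : ℝ) (hε : 0 < ε) (hε1 : ε < 1) (hε' : 0 < ε')
    (ρ : Heterodyne.Fock →L[ℂ] Heterodyne.Fock) (hρ : Heterodyne.IsDensityOperator ρ)
    (hsupp : Heterodyne.HasBoundedSupport E ρ)
    (α : Fin n → Ω → ℂ) (hindep : iIndepFun α P)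
    (hlaw : ∀ i, HasLaw (α i) (Heterodyne.heterodyneLaw ρ) P) :
    1 - 4 * ∑ l ∈ Finset.range (E + 1), ∑ k ∈ Finset.range (l + 1),
        Real.exp (-(n * ε ^ (2 + k + l) * ε' ^ 2 / (4 * Heterodyne.constC k l)))
      < P.real {ω | ∀ k ≤ E, ∀ l ≤ E,
          ‖Heterodyne.matEl ρ k l - Heterodyne.estimate E ε (fun i => α i ω) k l‖ ≤ ε + ε'} := by
  set g : ℕ → ℕ → ℂ → ℂ := fun k l =>
    entryEst k l (ε / Real.sqrt (((k : ℝ) + 1) * ((l : ℝ) + 1))) with hg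
  set bad : ℕ → ℕ → Set Ω := fun k l =>
    {ω | ε' < ‖(∫ z, g k l z ∂(heterodyneLaw ρ)) - 1 / (n : ℂ) * ∑ i, g k l (α i ω)‖} with hbad
  set good : Set Ω := {ω | ∀ k ≤ E, ∀ l ≤ E,
    ‖matEl ρ k l - estimate E ε (fun i => α i ω) k l‖ ≤ ε + ε'} with hgood
  have hgc (k l : ℕ) : Continuous (g k l) := continuous_entryEst k l _
  have hMpos (k l : ℕ) : 0 < Real.sqrt (constC k l / ε ^ (2 + k + l)) :=
    Real.sqrt_pos.2 (div_pos (constC_pos k l) (by positivity))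
  have hMb (k l : ℕ) (z : ℂ) : ‖g k l z‖ ≤ Real.sqrt (constC k l / ε ^ (2 + k + l)) :=
    Real.le_sqrt_of_sq_le (norm_sq_entryEst_le k l hε hε1 z)
  have hexp (k l : ℕ) : n * ε' ^ 2 / (4 * Real.sqrt (constC k l / ε ^ (2 + k + l)) ^ 2) =
      n * ε ^ (2 + k + l) * ε' ^ 2 / (4 * constC k l) := by
    have := constC_pos k l
    rw [Real.sq_sqrt (by positivity)]
    field_simp
  have hle (k l : ℕ) : P.real (bad k l) ≤
      4 * Real.exp (-(n * ε ^ (2 + k + l) * ε' ^ 2 / (4 * constC k l))) := by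
    rw [← hexp k l]
    exact measureReal_norm_integral_sub_mean_gt_le hn hindep hlaw (hgc k l) (hMpos k l)
      (hMb k l) hε'
  have hlt (k : ℕ) : P.real (bad k k) <
      4 * Real.exp (-(n * ε ^ (2 + k + k) * ε' ^ 2 / (4 * constC k k))) := by
    rw [← hexp k k]
    exact measureReal_norm_integral_sub_mean_gt_lt_of_real hn hindep hlaw (hgc k k) (hMpos k k)
      (hMb k k) hε' fun z => Complex.conj_eq_iff_im.1 (entryEst_swap k k _ z).symm
  have hsum : ∑ l ∈ Finset.range (E + 1), ∑ k ∈ Finset.range (l + 1), P.real (bad k l) <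
      4 * ∑ l ∈ Finset.range (E + 1), ∑ k ∈ Finset.range (l + 1),
        Real.exp (-(n * ε ^ (2 + k + l) * ε' ^ 2 / (4 * constC k l))) := by
    simp only [Finset.mul_sum]
    refine Finset.sum_lt_sum (fun l _ => Finset.sum_le_sum fun k _ => hle k l)
      -- The inner sum for `l = 0` is the single diagonal pair `(0, 0)`, present for every `E`.
      ⟨0, by simp, ?_⟩
    simpa using hlt 0
  -- Covering the whole space and using subadditivity avoids any measurability question about
  -- `good`.
  have hcover : (Set.univ : Set Ω) ⊆ good ∪
      ⋃ l ∈ Finset.range (E + 1), ⋃ k ∈ Finset.range (l + 1), bad k l := by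
    intro ω _
    by_contra hω
    simp only [Set.mem_union, Set.mem_iUnion, not_or, not_exists, Finset.mem_range] at hω
    refine hω.1 ?_
    have hord (k l : ℕ) (hkl : k ≤ l) (hl : l ≤ E) :
        ‖matEl ρ k l - estimate E ε (fun i => α i ω) k l‖ ≤ ε + ε' := by
      have h1 := norm_matEl_sub_integral_entryEst_le (hkl.trans hl) hl hρ hsupp hε hε1
      have h2 : ‖(∫ z, g k l z ∂(heterodyneLaw ρ)) - 1 / (n : ℂ) * ∑ i, g k l (α i ω)‖ ≤ ε' :=
        not_lt.1 (hω.2 l (by omega) k (by omega))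
      rw [estimate_eq (hkl.trans hl) hl]
      exact (norm_sub_le_norm_sub_add_norm_sub _ _ _).trans (add_le_add h1 h2)
    intro k hk l hl
    rcases le_total k l with hkl | hkl
    · exact hord k l hkl hl
    · have := hord l k hkl hk
      rwa [matEl_swap hρ l k, estimate_swap hl hk, ← map_sub, Complex.norm_conj]
  have huniv : (1 : ℝ) ≤ P.real good +
      ∑ l ∈ Finset.range (E + 1), ∑ k ∈ Finset.range (l + 1), P.real (bad k l) := by
    calc (1 : ℝ) = P.real Set.univ := probReal_univ.symm
      _ ≤ P.real (good ∪ ⋃ l ∈ Finset.range (E + 1), ⋃ k ∈ Finset.range (l + 1), bad k l) :=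
        measureReal_mono hcover
      _ ≤ P.real good + P.real (⋃ l ∈ Finset.range (E + 1),
          ⋃ k ∈ Finset.range (l + 1), bad k l) := measureReal_union_le _ _
      _ ≤ _ := by
        gcongr
        refine (measureReal_biUnion_finset_le _ _).trans (Finset.sum_le_sum fun l _ => ?_)
        exact measureReal_biUnion_finset_le _ _
  linarith
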